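/- For a composition $\mathbf k=(k_1,\dots,k_r)$ of positive integers and an integer $n\ge 0$ put $$\zeta_n(\mathbf k)=\sum_{n\ge n_1>\cdots>n_r>0}\frac1{n_1^{k_1}\cdots n_r^{k_r}},\qquad \zeta_n^\star(\mathbf k)=\sum_{n\ge n_1\ge\cdots\ge n_r>0}\frac1{n_1^{k_1}\cdots n_r^{k_r}},\qquad \zeta_n(\emptyset)=\zeta_n^\star(\emptyset)=1,$$ and let $1_d=(1,\dots,1)$ ($d$ entries). A colored multiple zeta value (CMZV) of level $N$ is a value $$\mathrm{Li}_{\mathbf k}(\mathbf z)=\lim_{n\to\infty}\ \sum_{n\ge n_1>\cdots>n_r>0}\frac{z_1^{n_1}\cdots z_r^{n_r}}{n_1^{k_1}\cdots n_r^{k_r}},$$ where the $k_j$ are positive integers, the $z_j$ are $N$-th roots of unity and $(k_1,z_1)\ne(1,1)$; the empty index ($r=0$) is allowed and has value $1$. Let $\mathrm{CMZV}^{\le N}\subset\mathbb C$ be the $\mathbb Q$-span of all CMZVs of levels $1,\dots,N$. Theorem. Let $m\ge 0$ be an integer. All series below converge absolutely, and $$\sum_{n=0}^\infty\left[\frac1{4^n}\binom{2n}{n}\right]^2\frac1{(n+1)^{m+1}}=\frac4\pi\left\{1+\sum_{k=1}^m\sum_{n=1}^\infty(-1)^n\frac{\zeta_{n-1}(1_{k-1})\,\zeta^\star_{n+1}(1_{m-k})}{n(n+1)(2n+1)}\right\},$$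 $$\sum_{n=0}^\infty\left[\frac1{4^n}\binom{2n}{n}\right]^2\frac{\zeta^\star_{n+1}(1_m)}{n+1}=\frac4\pi\left\{1+\sum_{k=1}^m\sum_{n=1}^\infty\frac{\zeta_{n-1}(1_{k-1})\,\zeta^\star_{n+1}(1_{m-k})}{n(n+1)(2n+1)}\right\}.$$ Moreover, the first sum lies in $\frac1\pi\left(\mathrm{CMZV}^{\le4}+i\,\mathrm{CMZV}^{\le4}\right)$, that is, it is $\frac1\pi$ times a linear combination with coefficients in $\mathbb Q(i)$ of CMZVs of level at most $4$, and the second sum lies in $\frac1\pi\,\mathrm{CMZV}^{\le2}$. -/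

import Mathlib

open Filter Topology

noncomputable section

/-- The multiple harmonic sum `ζ_n(k₁,…,k_r) = ∑_{n ≥ n₁ > ⋯ > n_r > 0} ∏ 1 / n_j ^ k_j`,
by recursion on the outermost index `n₁`; the empty composition gives `1`. -/
def mhs : List ℕ → ℕ → ℝ
  | [], _ => 1
  | k :: ks, n => ∑ j ∈ Finset.Icc 1 n, 1 / (j : ℝ) ^ k * mhs ks (j - 1)

/-- The multiple harmonic star sum
`ζ⋆_n(k₁,…,k_r) = ∑_{n ≥ n₁ ≥ ⋯ ≥ n_r > 0} ∏ 1 / n_j ^ k_j`;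
the empty composition gives `1`. -/
def mhsStar : List ℕ → ℕ → ℝ
  | [], _ => 1
  | k :: ks, n => ∑ j ∈ Finset.Icc 1 n, 1 / (j : ℝ) ^ k * mhsStar ks j

/-- The composition `1_d = (1,…,1)` with `d` repetitions. -/
def ones (d : ℕ) : List ℕ := List.replicate d 1

/-- The truncation `∑_{n ≥ n₁ > ⋯ > n_r > 0} ∏ z_j ^ n_j / n_j ^ k_j` of the series defining
`Li_{k₁,…,k_r}(z₁,…,z_r)`; the list holds the pairs `(k_j, z_j)`. -/
def cmzvPartial : List (ℕ × ℂ) → ℕ → ℂ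
  | [], _ => 1
  | p :: w, n => ∑ j ∈ Finset.Icc 1 n, p.2 ^ j / (j : ℂ) ^ p.1 * cmzvPartial w (j - 1)

/-- `(k; z)` is an admissible index of level `N`: all `k_j` are positive integers, all `z_j` are
`N`-th roots of unity, and `(k₁, z₁) ≠ (1, 1)`. The empty index is admissible. -/
def CMZVAdmissible (N : ℕ) (w : List (ℕ × ℂ)) : Prop :=
  (∀ p ∈ w, 1 ≤ p.1 ∧ p.2 ^ N = 1) ∧ ∀ p ∈ w.head?, p ≠ (1, 1)

/-- `x` is a colored multiple zeta value of level `N`. The series may converge only conditionally,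
so its value is the limit of the truncations `n₁ ≤ n` for `n → ∞`. -/
def IsCMZV (N : ℕ) (x : ℂ) : Prop :=
  ∃ w : List (ℕ × ℂ), CMZVAdmissible N w ∧ Tendsto (cmzvPartial w) atTop (𝓝 x)

/-- `CMZV^{≤ N}`: the `ℚ`-span in `ℂ` of the colored multiple zeta values of all levels
`1 ≤ M ≤ N`. -/
def CMZVle (N : ℕ) : Submodule ℚ ℂ :=
  Submodule.span ℚ {x : ℂ | ∃ M : ℕ, 1 ≤ M ∧ M ≤ N ∧ IsCMZV M x}

/-- The squared normalised central binomial coefficient `(binom(2n,n) / 4^n)^2`. -/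
def binomSq (n : ℕ) : ℝ := ((Nat.centralBinom n : ℝ) / 4 ^ n) ^ 2

/-- The general term `ζ_{n-1}(1_{k-1}) ζ⋆_{n+1}(1_{m-k}) / (n (n+1) (2n+1))`,
used for `n ≥ 1` and `1 ≤ k ≤ m` only. -/
def doubleTerm (m k n : ℕ) : ℝ :=
  mhs (ones (k - 1)) (n - 1) * mhsStar (ones (m - k)) (n + 1) /
    ((n : ℝ) * ((n : ℝ) + 1) * (2 * (n : ℝ) + 1))

end

/-!
# Squared central binomial series and colored multiple zeta values

Let `a_N = binom(2N, N) / 4 ^ N` and work in `ℝ⟦X⟧`, where `X` is the generating variable for `m`.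
In one case the weights `1 / (N + 1) ^ (m + 1)` have the generating function `1 / (N + 1 - X)`, in
the other the weights `ζ⋆_{N+1}(1_m) / (N + 1)` have `N! / ∏_{1 ≤ j ≤ N + 1} (j - X)`; these are the
integrals of `t ^ N` against `t ^ (-X)` and `(1 - t) ^ (-X)` over `[0, 1]`.

*The explicit formulas.* They are Parseval's identity for the shifted Legendre polynomials, applied
to the complete elliptic integral `∑ a_N² t ^ N`. Up to sign, the Legendre moments of the two
weights agree: they are the coefficients of `legendreGen n = (X)_n / (1 - X)_{n+1}`, which are
products of harmonic sums by `coeff_legendreGen_succ`. The expansion of `t ^ N` in Legendre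
polynomials becomes the two finite identities `sum_alternating_legendreGen` and `sum_legendreGen`.
The Legendre coefficients of the elliptic integral are evaluated in
`hasSum_binomSq_mul_legendreCoeff`: the partial sums have a closed form, and Wallis' product gives
the limit. All terms without sign are nonnegative, so the two summations may be interchanged.

*The second series.* Its generating function is, up to a factor, `₂F₁(1/2, 1/2; 2 - X; 1)`.
Iterating Gauss' contiguity relation `hyperSum_contiguous` gives `(4 / π) (1 - 2X) ^ (-2)` times the
product of `(1 - 2X / j) ^ (∓ 2)` over even and odd `j`. The linear terms of these factors are
`4 (-1) ^ j X / j`, so multiplying out produces only words of level two without the letter `(1, 1)`,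
and these converge.

*The first series.* Here `legendreGen n / (2n + 1)` is decomposed into partial fractions. In the
alternating sum all terms telescope except for `∏_{j ≤ n} (j + X) / (j - X)` divided by `2n + 1`
(`one_sub_sq_mul_sum_legendreGen`). Written as a sum over the integer `2n + 1`, this becomes a
combination of words of level four with first letter `(1, ± i)`.

In both cases only truncated sums are manipulated. Their limits exist by Dirichlet's test, as
truncated sums grow at most like a power of the harmonic numbers (`exists_tendsto_cmzvPartial`).
-/

/-! ### Growth of nested harmonic sums -/

section Growth

theorem harmonic_cast_nonneg (n : ℕ) : (0 : ℝ) ≤ harmonic n := by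
  rw [harmonic]
  push_cast
  positivity

theorem harmonic_cast_eq_sum (n : ℕ) :
    (harmonic n : ℝ) = ∑ j ∈ Finset.Icc 1 n, 1 / (j : ℝ) := by
  rw [harmonic_eq_sum_Icc]
  push_cast
  simp

theorem harmonic_cast_mono : Monotone fun n : ℕ => (harmonic n : ℝ) := by
  refine monotone_nat_of_le_succ fun n => ?_
  rw [harmonic_succ]
  push_cast
  have : (0 : ℝ) ≤ ((n : ℝ) + 1)⁻¹ := by positivity
  linarith

/-- Powers of the harmonic numbers grow more slowly than the square root: this is
`log x ≤ x ^ ε / ε` for a small enough `ε`. -/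
theorem exists_harmonic_pow_le_sqrt (r : ℕ) :
    ∃ c : ℝ, 0 < c ∧ ∀ n : ℕ, (harmonic n : ℝ) ^ r ≤ c * √((n : ℝ) + 1) := by
  set ε : ℝ := 1 / (2 * ((r : ℝ) + 1)) with hε
  have hε0 : 0 < ε := by positivity
  refine ⟨(1 + 1 / ε) ^ r, by positivity, fun n => ?_⟩
  have hx1 : (1 : ℝ) ≤ (n : ℝ) + 1 := by linarith [(Nat.cast_nonneg n : (0 : ℝ) ≤ n)]
  have hpow : (1 : ℝ) ≤ ((n : ℝ) + 1) ^ ε := Real.one_le_rpow hx1 hε0.le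
  have h1 : (harmonic n : ℝ) ≤ (1 + 1 / ε) * ((n : ℝ) + 1) ^ ε := by
    have h2 := harmonic_cast_mono (Nat.le_succ n)
    have h3 := harmonic_le_one_add_log (n + 1)
    have h4 := Real.log_le_rpow_div (x := (n : ℝ) + 1) (by linarith) hε0
    push_cast at h3
    simp only [Nat.succ_eq_add_one] at h2
    rw [add_mul, one_mul, one_div_mul_eq_div]
    linarith
  calc (harmonic n : ℝ) ^ r ≤ ((1 + 1 / ε) * ((n : ℝ) + 1) ^ ε) ^ r :=
        pow_le_pow_left₀ (harmonic_cast_nonneg n) h1 r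
    _ = (1 + 1 / ε) ^ r * ((n : ℝ) + 1) ^ (ε * r) := by
        rw [mul_pow, Real.rpow_mul_natCast (by linarith)]
    _ ≤ (1 + 1 / ε) ^ r * √((n : ℝ) + 1) := by
        rw [Real.sqrt_eq_rpow]
        refine mul_le_mul_of_nonneg_left (Real.rpow_le_rpow_of_exponent_le hx1 ?_) (by positivity)
        rw [hε, one_div_mul_eq_div, div_le_div_iff₀ (by positivity) (by norm_num)]
        linarith

theorem sum_harmonic_pow_div_le (r n : ℕ) :
    ∑ j ∈ Finset.Icc 1 n, 1 / (j : ℝ) * (harmonic j : ℝ) ^ r ≤ (harmonic n : ℝ) ^ (r + 1) := by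
  rw [pow_succ', harmonic_cast_eq_sum n, Finset.sum_mul, ← harmonic_cast_eq_sum]
  refine Finset.sum_le_sum fun j hj => ?_
  refine mul_le_mul_of_nonneg_left ?_ (by positivity)
  exact pow_le_pow_left₀ (harmonic_cast_nonneg j)
    (harmonic_cast_mono (Finset.mem_Icc.mp hj).2) r

theorem ones_succ (d : ℕ) : ones (d + 1) = 1 :: ones d := rfl

theorem mhs_nonneg (w : List ℕ) (n : ℕ) : 0 ≤ mhs w n := by
  induction w generalizing n with
  | nil => simp [mhs]
  | cons k w ih => exact Finset.sum_nonneg fun j _ => mul_nonneg (by positivity) (ih _)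

theorem mhsStar_nonneg (w : List ℕ) (n : ℕ) : 0 ≤ mhsStar w n := by
  induction w generalizing n with
  | nil => simp [mhsStar]
  | cons k w ih => exact Finset.sum_nonneg fun j _ => mul_nonneg (by positivity) (ih _)

theorem mhs_ones_le (d n : ℕ) : mhs (ones d) n ≤ (harmonic n : ℝ) ^ d := by
  induction d generalizing n with
  | zero => simp [ones, mhs]
  | succ d ih =>
    refine le_trans ?_ (sum_harmonic_pow_div_le d n)
    simp only [ones_succ, mhs, pow_one]
    refine Finset.sum_le_sum fun j _ => mul_le_mul_of_nonneg_left ?_ (by positivity)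
    exact (ih _).trans (pow_le_pow_left₀ (harmonic_cast_nonneg _)
      (harmonic_cast_mono (Nat.sub_le j 1)) d)

theorem mhsStar_ones_le (d n : ℕ) : mhsStar (ones d) n ≤ (harmonic n : ℝ) ^ d := by
  induction d generalizing n with
  | zero => simp [ones, mhsStar]
  | succ d ih =>
    refine le_trans ?_ (sum_harmonic_pow_div_le d n)
    simp only [ones_succ, mhsStar, pow_one]
    exact Finset.sum_le_sum fun j _ => mul_le_mul_of_nonneg_left (ih _) (by positivity)

theorem norm_cmzvPartial_le (w : List (ℕ × ℂ)) (hw : ∀ p ∈ w, 1 ≤ p.1 ∧ ‖p.2‖ ≤ 1) (n : ℕ) :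
    ‖cmzvPartial w n‖ ≤ (harmonic n : ℝ) ^ w.length := by
  induction w generalizing n with
  | nil => simp [cmzvPartial]
  | cons p w ih =>
    obtain ⟨hp1, hp2⟩ := hw p (by simp)
    refine le_trans ?_ (sum_harmonic_pow_div_le w.length n)
    simp only [cmzvPartial]
    refine norm_sum_le_of_le _ fun j hj => ?_
    have hj1 : (1 : ℝ) ≤ j := by exact_mod_cast (Finset.mem_Icc.mp hj).1
    rw [norm_mul, norm_div, norm_pow, norm_pow, Complex.norm_natCast]
    refine mul_le_mul ?_ ?_ (norm_nonneg _) (by positivity)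
    · exact div_le_div₀ zero_le_one (pow_le_one₀ (norm_nonneg _) hp2) (by linarith)
        (le_self_pow₀ hj1 (by omega))
    · exact (ih (fun q hq => hw q (by simp [hq])) _).trans
        (pow_le_pow_left₀ (harmonic_cast_nonneg _) (harmonic_cast_mono (Nat.sub_le j 1)) _)

/-- The comparison series for everything that decays like `log ^ r n / n ^ 2`. -/
theorem summable_harmonic_pow_div_sq (r : ℕ) :
    Summable fun n : ℕ => (harmonic n : ℝ) ^ r / ((n : ℝ) + 1) ^ 2 := by
  obtain ⟨c, hc, h⟩ := exists_harmonic_pow_le_sqrt r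
  have hs : Summable fun n : ℕ => c * (1 / ((n : ℝ) + 1) ^ (3 / 2 : ℝ)) := by
    refine Summable.mul_left c ?_
    have := (summable_nat_add_iff 1).mpr
      (Real.summable_one_div_nat_rpow.mpr (by norm_num : (1 : ℝ) < 3 / 2))
    simpa using this
  refine hs.of_nonneg_of_le
    (fun n => div_nonneg (pow_nonneg (harmonic_cast_nonneg n) r) (by positivity)) fun n => ?_
  have hn : (0 : ℝ) < (n : ℝ) + 1 := by positivity
  rw [mul_one_div, div_le_div_iff₀ (by positivity) (by positivity)]
  have h2 : ((n : ℝ) + 1) ^ 2 = √((n : ℝ) + 1) * ((n : ℝ) + 1) ^ (3 / 2 : ℝ) := by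
    rw [Real.sqrt_eq_rpow, ← Real.rpow_add hn, ← Real.rpow_natCast]
    norm_num
  calc _ ≤ c * √((n : ℝ) + 1) * ((n : ℝ) + 1) ^ (3 / 2 : ℝ) :=
        mul_le_mul_of_nonneg_right (h n) (by positivity)
    _ = _ := by rw [h2, mul_assoc]

theorem tendsto_harmonic_pow_div (r : ℕ) :
    Tendsto (fun n : ℕ => (harmonic n : ℝ) ^ r / ((n : ℝ) + 1)) atTop (𝓝 0) := by
  obtain ⟨c, hc, h⟩ := exists_harmonic_pow_le_sqrt r
  have hs : Tendsto (fun n : ℕ => c * (√((n : ℝ) + 1))⁻¹) atTop (𝓝 0) := by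
    have : Tendsto (fun n : ℕ => (n : ℝ) + 1) atTop atTop :=
      tendsto_atTop_add_const_right _ _ tendsto_natCast_atTop_atTop
    simpa using ((tendsto_inv_atTop_zero.comp (Real.tendsto_sqrt_atTop.comp this)).const_mul c)
  refine squeeze_zero
    (fun n => div_nonneg (pow_nonneg (harmonic_cast_nonneg n) r) (by positivity)) (fun n => ?_) hs
  have hn : (0 : ℝ) < (n : ℝ) + 1 := by positivity
  rw [div_le_iff₀ hn]
  refine (h n).trans (le_of_eq ?_)
  have hsq := Real.mul_self_sqrt hn.le
  have hpos := Real.sqrt_pos.mpr hn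
  field_simp
  rw [sq, hsq]

end Growth

section Legendre

open PowerSeries

/-! ### Generating functions -/

/-- The power series `(c - X)⁻¹ = ∑ X ^ k / c ^ (k + 1)`, for `c ≠ 0`. -/
noncomputable def geomInv (c : ℝ) : ℝ⟦X⟧ := PowerSeries.mk fun k => (c⁻¹) ^ (k + 1)

theorem coeff_geomInv (c : ℝ) (k : ℕ) : coeff k (geomInv c) = (c⁻¹) ^ (k + 1) := by
  simp [geomInv]

theorem sub_X_mul_geomInv {c : ℝ} (hc : c ≠ 0) : (C c - X) * geomInv c = 1 := by
  ext k
  cases k with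
  | zero => simp [geomInv, sub_mul, hc]
  | succ k =>
    rw [sub_mul, map_sub, coeff_C_mul, coeff_succ_X_mul, coeff_geomInv, coeff_geomInv, coeff_one,
      pow_succ _ (k + 1)]
    simp
    field_simp
    simp

/-- The generating function `∏_{j ≤ n} (1 + X / j)` of the sums `ζ_n(1_k)`. -/
noncomputable def mhsGen : ℕ → ℝ⟦X⟧
  | 0 => 1
  | n + 1 => mhsGen n * (1 + C (((n : ℝ) + 1)⁻¹) * X)

/-- The generating function `∏_{j ≤ n} (1 - X / j)⁻¹` of the star sums `ζ⋆_n(1_k)`. -/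
noncomputable def mhsStarGen : ℕ → ℝ⟦X⟧
  | 0 => 1
  | n + 1 => mhsStarGen n * (C ((n : ℝ) + 1) * geomInv ((n : ℝ) + 1))

theorem coeff_mhsGen (k n : ℕ) : coeff k (mhsGen n) = mhs (ones k) n := by
  induction n generalizing k with
  | zero =>
    cases k with
    | zero => simp [mhsGen, ones, mhs]
    | succ k => simp [mhsGen, ones_succ, mhs, coeff_one]
  | succ n ih =>
    rw [mhsGen, mul_add, mul_one, map_add, ih]
    cases k with
    | zero => simp [ones, mhs]
    | succ k =>
      rw [mul_left_comm, coeff_C_mul, coeff_succ_mul_X, ih, ones_succ, mhs, mhs,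
        Finset.sum_Icc_succ_top (by omega)]
      simp

theorem mhsStarGen_succ_mul (n : ℕ) :
    mhsStarGen (n + 1) = mhsStarGen n + C (((n : ℝ) + 1)⁻¹) * (X * mhsStarGen (n + 1)) := by
  have hn : (n : ℝ) + 1 ≠ 0 := by positivity
  have h := sub_X_mul_geomInv hn
  have h2 : C (((n : ℝ) + 1)⁻¹) * C ((n : ℝ) + 1) = 1 := by
    rw [← map_mul, inv_mul_cancel₀ hn, map_one]
  rw [mhsStarGen]
  linear_combination mhsStarGen n * h +
    (-mhsStarGen n * X * geomInv ((n : ℝ) + 1)) * h2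

theorem coeff_mhsStarGen (k n : ℕ) : coeff k (mhsStarGen n) = mhsStar (ones k) n := by
  induction n generalizing k with
  | zero =>
    cases k with
    | zero => simp [mhsStarGen, ones, mhsStar]
    | succ k => simp [mhsStarGen, ones_succ, mhsStar, coeff_one]
  | succ n ihn =>
    induction k with
    | zero =>
      rw [mhsStarGen_succ_mul, map_add, ihn, coeff_C_mul]
      simp [ones, mhsStar]
    | succ k ihk =>
      rw [mhsStarGen_succ_mul, map_add, ihn, coeff_C_mul, coeff_succ_X_mul, ihk, ones_succ,
        mhsStar, mhsStar, Finset.sum_Icc_succ_top (by omega)]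
      simp

/-- The generating function `(X)_n / (1 - X)_{n+1}` (rising factorials) of the moments
`∫₀¹ P_n(1 - 2t) (-log t) ^ m / m! dt` of the shifted Legendre polynomials. -/
noncomputable def legendreGen : ℕ → ℝ⟦X⟧
  | 0 => geomInv 1
  | n + 1 => legendreGen n * ((n : ℝ⟦X⟧) + X) * geomInv ((n : ℝ) + 2)

theorem one_sub_X_mul_legendreGen_zero : (1 - X) * legendreGen 0 = 1 := by
  simpa [legendreGen] using sub_X_mul_geomInv (c := 1) one_ne_zero

theorem sub_X_mul_legendreGen_succ (n : ℕ) :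
    ((n : ℝ⟦X⟧) + 2 - X) * legendreGen (n + 1) = ((n : ℝ⟦X⟧) + X) * legendreGen n := by
  have h := sub_X_mul_geomInv (c := (n : ℝ) + 2) (by positivity)
  rw [map_add, map_natCast, map_ofNat] at h
  rw [legendreGen]
  linear_combination (legendreGen n * ((n : ℝ⟦X⟧) + X)) * h

theorem C_two : C (2 : ℝ) = (2 : ℝ⟦X⟧) := map_ofNat C 2

theorem C_inv_mul_natCast (n : ℕ) : C (((n : ℝ) + 1)⁻¹) * ((n : ℝ⟦X⟧) + 1) = 1 := by
  have hn : (n : ℝ) + 1 ≠ 0 := by positivity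
  have : (n : ℝ⟦X⟧) + 1 = C ((n : ℝ) + 1) := by simp
  rw [this, ← map_mul, inv_mul_cancel₀ hn, map_one]

theorem legendreGen_succ_eq (n : ℕ) :
    legendreGen (n + 1) =
      C (((n : ℝ) + 1)⁻¹ * ((n : ℝ) + 1 + 1)⁻¹) * (X * (mhsGen n * mhsStarGen (n + 2))) := by
  induction n with
  | zero =>
    simp only [legendreGen, mhsGen, mhsStarGen]
    have h := C_inv_mul_natCast 1
    norm_num at h ⊢
    rw [C_two]
    linear_combination (-geomInv 1 * X * geomInv 2) * h
  | succ n ih =>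
    have e1 : C (((n : ℝ) + 1)⁻¹) * ((n : ℝ⟦X⟧) + 1) = 1 := C_inv_mul_natCast n
    have e3 := C_inv_mul_natCast (n + 2)
    rw [legendreGen, ih, mhsGen, mhsStarGen.eq_2 (n + 2)]
    push_cast at *
    rw [show (n : ℝ) + 1 + 2 = n + 2 + 1 by ring, show (n : ℝ) + 1 + 1 = n + 2 by ring]
    simp only [map_mul, map_add, map_natCast, map_one, map_ofNat] at *
    linear_combination
      (C ((n : ℝ) + 2)⁻¹ * X * (mhsGen n * mhsStarGen (n + 2)) * geomInv ((n : ℝ) + 2 + 1)) *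
        (e1 + (-1 - C (((n : ℝ) + 1)⁻¹) * X) * e3)

/-- The numerator of `doubleTerm m k n`, summed over `k`, is a moment of a Legendre polynomial. -/
theorem coeff_legendreGen_succ (m n : ℕ) :
    coeff m (legendreGen (n + 1)) =
      ∑ k ∈ Finset.Icc 1 m, mhs (ones (k - 1)) n * mhsStar (ones (m - k)) (n + 2) /
        (((n : ℝ) + 1) * ((n : ℝ) + 1 + 1)) := by
  rw [legendreGen_succ_eq, coeff_C_mul]
  cases m with
  | zero => simp
  | succ m =>
    rw [coeff_succ_X_mul, coeff_mul, Finset.Nat.sum_antidiagonal_eq_sum_range_succ_mk,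
      Finset.mul_sum, show Finset.Icc 1 (m + 1) = Finset.Ico (0 + 1) (m + 1 + 1) by
        ext; simp only [Finset.mem_Icc, Finset.mem_Ico]; omega,
      ← Finset.sum_Ico_add', Finset.range_eq_Ico]
    refine Finset.sum_congr rfl fun k hk => ?_
    rw [coeff_mhsGen, coeff_mhsStarGen, Nat.add_sub_cancel, Nat.add_sub_add_right, ← mul_inv,
      inv_mul_eq_div]

theorem coeff_legendreGen_zero (m : ℕ) : coeff m (legendreGen 0) = 1 := by
  simp [legendreGen, coeff_geomInv]

theorem coeff_legendreGen_nonneg (m n : ℕ) : 0 ≤ coeff m (legendreGen n) := by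
  cases n with
  | zero => simp [coeff_legendreGen_zero]
  | succ n =>
    rw [coeff_legendreGen_succ]
    exact Finset.sum_nonneg fun k _ =>
      div_nonneg (mul_nonneg (mhs_nonneg _ _) (mhsStar_nonneg _ _)) (by positivity)

/-! ### Expanding monomials in Legendre polynomials -/

/-- The number `N! ^ 2 / ((N - n)! (N + n + 1)!)`, which is `0` for `n > N`. Multiplied by
`2 n + 1` it is the coefficient of the shifted Legendre polynomial `P_n(2t - 1)` in `t ^ N`. The
recursion in `n` avoids truncated subtraction. -/
noncomputable def legendreCoeff (N : ℕ) : ℕ → ℝ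
  | 0 => ((N : ℝ) + 1)⁻¹
  | n + 1 => legendreCoeff N n * ((N : ℝ) - n) / ((N : ℝ) + n + 2)

theorem legendreCoeff_succ_mul (N n : ℕ) :
    legendreCoeff N (n + 1) * ((N : ℝ) + n + 2) = legendreCoeff N n * ((N : ℝ) - n) := by
  rw [legendreCoeff]
  exact div_mul_cancel₀ _ (by positivity)

theorem legendreCoeff_eq_zero {N n : ℕ} (h : N < n) : legendreCoeff N n = 0 := by
  induction n, h using Nat.le_induction with
  | base => simp [legendreCoeff]
  | succ n _ ih => simp [legendreCoeff, ih]

theorem legendreCoeff_nonneg (N n : ℕ) : 0 ≤ legendreCoeff N n := by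
  rcases lt_or_ge N n with h | h
  · rw [legendreCoeff_eq_zero h]
  · induction n with
    | zero => simp only [legendreCoeff]; positivity
    | succ n ih =>
      have : (n : ℝ) + 1 ≤ N := by exact_mod_cast h
      have h0 := ih (by omega)
      rw [legendreCoeff]
      exact div_nonneg (mul_nonneg h0 (by linarith)) (by positivity)

theorem legendreCoeff_shift (N n : ℕ) :
    legendreCoeff (N + 1) n * (((N : ℝ) + 1 - n) * ((N : ℝ) + n + 2)) =
      ((N : ℝ) + 1) ^ 2 * legendreCoeff N n := by
  induction n with
  | zero => 
    simp only [legendreCoeff]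
    push_cast
    field_simp
    ring
  | succ n ih =>
    have h1 := legendreCoeff_succ_mul (N + 1) n
    have h2 := legendreCoeff_succ_mul N n
    have h3 : (N : ℝ) + n + 2 ≠ 0 := by positivity
    push_cast at *
    refine mul_right_cancel₀ h3 ?_
    linear_combination (((N : ℝ) - n) * (N + n + 2)) * h1 + ((N : ℝ) - n) * ih -
      ((N : ℝ) + 1) ^ 2 * h2

theorem C_legendreCoeff_succ_mul (N n : ℕ) :
    C (legendreCoeff N (n + 1)) * ((N : ℝ⟦X⟧) + n + 2) =
      C (legendreCoeff N n) * ((N : ℝ⟦X⟧) - n) := by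
  have h := congrArg (C : ℝ →+* ℝ⟦X⟧) (legendreCoeff_succ_mul N n)
  simpa only [map_mul, map_add, map_sub, map_natCast, C_two] using h

/-- The expansion of `∫₀¹ t ^ N t ^ (-X) dt` in Legendre moments. The partial sums over `n < K`
have a closed form, whose second term vanishes for `K > N`. -/
theorem sub_X_mul_sum_alternating_legendreGen (N K : ℕ) :
    ((N : ℝ⟦X⟧) + 1 - (X : ℝ⟦X⟧)) * ∑ n ∈ Finset.range K,
        (-1) ^ n * (2 * (n : ℝ⟦X⟧) + 1) * C (legendreCoeff N n) * legendreGen n =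
      1 - (-1) ^ K * ((K : ℝ⟦X⟧) + 1 - (X : ℝ⟦X⟧)) * ((N : ℝ⟦X⟧) + (K : ℝ⟦X⟧) + 1) *
        C (legendreCoeff N K) * legendreGen K := by
  induction K with
  | zero =>
    have h := one_sub_X_mul_legendreGen_zero
    have h2 := C_inv_mul_natCast N
    simp only [legendreCoeff, Finset.range_zero, Finset.sum_empty, Nat.cast_zero, pow_zero]
    linear_combination h * C (((N : ℝ) + 1)⁻¹) * ((N : ℝ⟦X⟧) + 1) + h2
  | succ K ih =>
    have h1 := sub_X_mul_legendreGen_succ K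
    have h2 := C_legendreCoeff_succ_mul N K
    rw [Finset.sum_range_succ, mul_add, ih]
    push_cast
    linear_combination
      (-(-1) ^ K * C (legendreCoeff N (K + 1)) * ((N : ℝ⟦X⟧) + (K : ℝ⟦X⟧) + 2)) * h1 +
      (-(-1) ^ K * (((K : ℝ⟦X⟧) + X) * legendreGen K)) * h2

theorem sum_alternating_legendreGen (N : ℕ) :
    ∑ n ∈ Finset.range (N + 1),
        (-1) ^ n * (2 * (n : ℝ⟦X⟧) + 1) * C (legendreCoeff N n) * legendreGen n =
      geomInv ((N : ℝ) + 1) := by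
  have h := sub_X_mul_sum_alternating_legendreGen N (N + 1)
  rw [legendreCoeff_eq_zero (Nat.lt_succ_self N)] at h
  have h2 := sub_X_mul_geomInv (c := (N : ℝ) + 1) (by positivity)
  simp only [map_add, map_natCast, map_one, map_zero, mul_zero, zero_mul, sub_zero] at h h2
  set S := ∑ n ∈ Finset.range (N + 1),
        (-1) ^ n * (2 * (n : ℝ⟦X⟧) + 1) * C (legendreCoeff N n) * legendreGen n
  linear_combination geomInv ((N : ℝ) + 1) * h - S * h2

/-- The recursion in `N` for `∑ n ≤ N, (2 n + 1) C (legendreCoeff N n) legendreGen n`, with the sum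
truncated at `n < K`. The boundary term vanishes for `K > N + 1`. -/
theorem sub_X_mul_sum_legendreGen_succ (N K : ℕ) :
    ((N : ℝ⟦X⟧) + 1) * (((N : ℝ⟦X⟧) + 2 - (X : ℝ⟦X⟧)) * ∑ n ∈ Finset.range K,
        (2 * (n : ℝ⟦X⟧) + 1) * C (legendreCoeff (N + 1) n) * legendreGen n -
      ((N : ℝ⟦X⟧) + 1) * ∑ n ∈ Finset.range K,
        (2 * (n : ℝ⟦X⟧) + 1) * C (legendreCoeff N n) * legendreGen n) =
      -((K : ℝ⟦X⟧) * ((N : ℝ⟦X⟧) + (K : ℝ⟦X⟧) + 2) * ((K : ℝ⟦X⟧) + 1 - (X : ℝ⟦X⟧)) *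
        C (legendreCoeff (N + 1) K) * legendreGen K) := by
  induction K with
  | zero => simp
  | succ K ih =>
    have h1 := sub_X_mul_legendreGen_succ K
    have h2 := C_legendreCoeff_succ_mul (N + 1) K
    have h3 : C (legendreCoeff (N + 1) K) * (((N : ℝ⟦X⟧) + 1 - K) * ((N : ℝ⟦X⟧) + (K : ℝ⟦X⟧) + 2)) =
        ((N : ℝ⟦X⟧) + 1) ^ 2 * C (legendreCoeff N K) := by
      have h := congrArg (C : ℝ →+* ℝ⟦X⟧) (legendreCoeff_shift N K)
      simpa only [map_mul, map_add, map_sub, map_pow, map_natCast, map_one, C_two] using h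
    rw [Finset.sum_range_succ, Finset.sum_range_succ]
    push_cast at *
    linear_combination ih + (2 * (K : ℝ⟦X⟧) + 1) * legendreGen K * h3 +
      (((K : ℝ⟦X⟧) + 1) * C (legendreCoeff (N + 1) (K + 1)) * ((N : ℝ⟦X⟧) + (K : ℝ⟦X⟧) + 3)) * h1 +
      (((K : ℝ⟦X⟧) + 1) * (((K : ℝ⟦X⟧) + X) * legendreGen K)) * h2

/-- The expansion of `∫₀¹ t ^ N (1 - t) ^ (-X) dt` in Legendre moments. Both sides satisfy
`(N + 2 - X) S_{N+1} = (N + 1) S_N`. -/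
theorem sum_legendreGen (N : ℕ) :
    ∑ n ∈ Finset.range (N + 1), (2 * (n : ℝ⟦X⟧) + 1) * C (legendreCoeff N n) * legendreGen n =
      C (((N : ℝ) + 1)⁻¹) * mhsStarGen (N + 1) := by
  induction N with
  | zero => simp [legendreCoeff, legendreGen, mhsStarGen]
  | succ N ih =>
    have h := sub_X_mul_sum_legendreGen_succ N (N + 2)
    rw [legendreCoeff_eq_zero (Nat.lt_succ_self (N + 1)), Finset.sum_range_succ _ (N + 1),
      Finset.sum_range_succ _ (N + 1), legendreCoeff_eq_zero (Nat.lt_succ_self N), ih] at h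
    rw [Finset.sum_range_succ]
    set S := ∑ n ∈ Finset.range (N + 1),
        (2 * (n : ℝ⟦X⟧) + 1) * C (legendreCoeff (N + 1) n) * legendreGen n
    have h2 := sub_X_mul_geomInv (c := (N : ℝ) + 2) (by positivity)
    have h3 := C_inv_mul_natCast N
    have h4 := C_inv_mul_natCast (N + 1)
    rw [mhsStarGen.eq_2 (N + 1)]
    push_cast at *
    rw [show (N : ℝ) + 1 + 1 = N + 2 by ring] at *
    simp only [map_add, map_natCast, map_ofNat, map_zero] at *
    set c := C (((N : ℝ) + 1)⁻¹)
    set d := C (((N : ℝ) + 2)⁻¹)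
    set g := geomInv ((N : ℝ) + 2)
    set T := S + (2 * ((N : ℝ⟦X⟧) + 1) + 1) * C (legendreCoeff (N + 1) (N + 1)) *
      legendreGen (N + 1)
    have h5 : ((N : ℝ⟦X⟧) + 2 - (X : ℝ⟦X⟧)) * T = mhsStarGen (N + 1) := by
      linear_combination c * h + (((N : ℝ⟦X⟧) + 1) * c * mhsStarGen (N + 1) + mhsStarGen (N + 1)
        - ((N : ℝ⟦X⟧) + 2 - (X : ℝ⟦X⟧)) * T) * h3
    linear_combination g * h5 - T * h2 - mhsStarGen (N + 1) * g * h4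

end Legendre

section Parseval

open PowerSeries

/-! ### Summation over the binomial coefficients -/

theorem binomSq_nonneg (n : ℕ) : 0 ≤ binomSq n := sq_nonneg _

theorem binomSq_succ_mul (n : ℕ) :
    binomSq (n + 1) * ((n : ℝ) + 1) ^ 2 = binomSq n * ((n : ℝ) + 1 / 2) ^ 2 := by
  have h : ((n : ℝ) + 1) * Nat.centralBinom (n + 1) = 2 * (2 * n + 1) * Nat.centralBinom n := by
    exact_mod_cast Nat.succ_mul_centralBinom_succ n
  have h2 : ((n : ℝ) + 1) * (Nat.centralBinom (n + 1) / 4 ^ (n + 1)) =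
      ((n : ℝ) + 1 / 2) * (Nat.centralBinom n / 4 ^ n) := by
    rw [← mul_div_assoc, h, pow_succ]
    field_simp
    ring
  unfold binomSq
  linear_combination (((n : ℝ) + 1) * (Nat.centralBinom (n + 1) / 4 ^ (n + 1)) +
      ((n : ℝ) + 1 / 2) * (Nat.centralBinom n / 4 ^ n)) * h2

theorem binomSq_mul_le_one (n : ℕ) : binomSq n * (2 * n + 1) ≤ 1 := by
  induction n with
  | zero => simp [binomSq]
  | succ n ih =>
    have h := binomSq_succ_mul n
    have h0 := binomSq_nonneg n
    have hn : (0 : ℝ) < ((n : ℝ) + 1) ^ 2 := by positivity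
    refine le_of_mul_le_mul_left ?_ hn
    push_cast
    calc ((n : ℝ) + 1) ^ 2 * (binomSq (n + 1) * (2 * (n + 1) + 1))
        = binomSq n * (2 * n + 1) * ((n + 1 / 2) * (n + 3 / 2)) := by
          linear_combination (2 * (n : ℝ) + 3) * h
      _ ≤ 1 * ((n + 1 / 2) * (n + 3 / 2)) := mul_le_mul_of_nonneg_right ih (by positivity)
      _ ≤ _ := by nlinarith

theorem binomSq_le (n : ℕ) : binomSq n ≤ 1 / ((n : ℝ) + 1) := by
  rw [le_div_iff₀ (by positivity)]
  refine le_trans (mul_le_mul_of_nonneg_left ?_ (binomSq_nonneg n)) (binomSq_mul_le_one n)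
  linarith [(Nat.cast_nonneg n : (0 : ℝ) ≤ n)]

theorem wallis_mul_binomSq (n : ℕ) : Real.Wallis.W n * ((2 * n + 1) * binomSq n) = 1 := by
  induction n with
  | zero => simp [Real.Wallis.W, binomSq]
  | succ n ih =>
    have h := binomSq_succ_mul n
    have hn : ((n : ℝ) + 1) ^ 2 ≠ 0 := by positivity
    rw [Real.Wallis.W_succ]
    rw [eq_div_of_mul_eq hn h]
    push_cast
    have h3 : (2 : ℝ) * ((n : ℝ) + 1) + 1 ≠ 0 := by positivity
    refine Eq.trans ?_ ih
    field_simp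
    ring

theorem tendsto_odd_mul_binomSq :
    Tendsto (fun n : ℕ => (2 * (n : ℝ) + 1) * binomSq n) atTop (𝓝 (2 / Real.pi)) := by
  have h := Real.Wallis.tendsto_W_nhds_pi_div_two.inv₀ (by positivity)
  rw [inv_div] at h
  exact h.congr fun n => (eq_inv_of_mul_eq_one_right (wallis_mul_binomSq n)).symm

theorem tendsto_natCast_mul_binomSq :
    Tendsto (fun n : ℕ => (n : ℝ) * binomSq n) atTop (𝓝 (1 / Real.pi)) := by
  have h := (tendsto_natCast_div_add_atTop (1 / 2 : ℝ)).mul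
    (tendsto_odd_mul_binomSq.mul_const (1 / 2))
  refine (h.congr fun n => ?_).trans (le_of_eq ?_)
  · have : (n : ℝ) + 1 / 2 ≠ 0 := by positivity
    field_simp
  · congr 1
    ring

theorem tendsto_natCast_mul_legendreCoeff (n : ℕ) :
    Tendsto (fun N : ℕ => (N : ℝ) * legendreCoeff N n) atTop (𝓝 1) := by
  induction n with
  | zero => exact tendsto_natCast_div_add_atTop (1 : ℝ)
  | succ n ih =>
    have h1 : Tendsto (fun N : ℕ => ((N : ℝ) - n) / ((N : ℝ) + (n + 2))) atTop (𝓝 1) := by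
      have h2 : Tendsto (fun N : ℕ => ((n : ℝ) * 2 + 2) / ((N : ℝ) + (n + 2))) atTop (𝓝 0) :=
        (tendsto_atTop_add_const_right _ _ tendsto_natCast_atTop_atTop).const_div_atTop _
      have h3 := h2.const_sub 1
      rw [sub_zero] at h3
      refine h3.congr fun N => ?_
      have : (N : ℝ) + (n + 2) ≠ 0 := by positivity
      field_simp
      ring
    have h := ih.mul h1
    rw [one_mul] at h
    refine h.congr fun N => ?_
    rw [legendreCoeff, add_assoc, mul_div_assoc, mul_assoc]

theorem sum_binomSq_mul_legendreCoeff (M n : ℕ) :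
    ∑ N ∈ Finset.range M, binomSq N * legendreCoeff N n * ((n : ℝ) + 1 / 2) ^ 2 =
      binomSq M * legendreCoeff M n * (((M : ℝ) - n) * ((M : ℝ) + n + 1)) := by
  induction M with
  | zero =>
    cases n with
    | zero => simp
    | succ n => simp [legendreCoeff_eq_zero (Nat.succ_pos n)]
  | succ M ih =>
    have h1 := legendreCoeff_shift M n
    have h2 := binomSq_succ_mul M
    rw [Finset.sum_range_succ, ih]
    push_cast
    linear_combination (-binomSq (M + 1)) * h1 - legendreCoeff M n * h2

/-- Up to the factor `2 n + 1`, the coefficient of the `n`-th shifted Legendre polynomial in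
`(2 / π) K`, where `K` is the complete elliptic integral as a function of its parameter. The closed
form of the partial sums is `sum_binomSq_mul_legendreCoeff`. -/
theorem hasSum_binomSq_mul_legendreCoeff (n : ℕ) :
    HasSum (fun N => binomSq N * legendreCoeff N n) (4 / Real.pi / (2 * n + 1) ^ 2) := by
  rw [hasSum_iff_tendsto_nat_of_nonneg
    fun N => mul_nonneg (binomSq_nonneg N) (legendreCoeff_nonneg N n)]
  have h0 : ((n : ℝ) + 1 / 2) ^ 2 ≠ 0 := by positivity
  have h1 : Tendsto (fun M : ℕ => ((M : ℝ) - n) * ((M : ℝ) + n + 1) * ((M : ℝ) ^ 2)⁻¹)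
      atTop (𝓝 1) := by
    have ha : Tendsto (fun M : ℕ => (n : ℝ) / (M : ℝ)) atTop (𝓝 0) :=
      tendsto_const_div_atTop_nhds_zero_nat _
    have hb : Tendsto (fun M : ℕ => ((n : ℝ) + 1) / (M : ℝ)) atTop (𝓝 0) :=
      tendsto_const_div_atTop_nhds_zero_nat _
    have hc := (ha.const_sub 1).mul (hb.const_add 1)
    simp only [sub_zero, add_zero, mul_one] at hc
    refine hc.congr' ?_
    filter_upwards [eventually_ge_atTop 1] with M hM
    have : (M : ℝ) ≠ 0 := by positivity
    field_simp
    ring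
  have h2 := ((tendsto_natCast_mul_binomSq.mul (tendsto_natCast_mul_legendreCoeff n)).mul h1).mul
    (tendsto_const_nhds (x := (((n : ℝ) + 1 / 2) ^ 2)⁻¹))
  have h3 : 1 / Real.pi * 1 * 1 * (((n : ℝ) + 1 / 2) ^ 2)⁻¹ = 4 / Real.pi / (2 * n + 1) ^ 2 := by
    field_simp
    ring
  rw [h3] at h2
  refine h2.congr' ?_
  filter_upwards [eventually_ge_atTop 1] with M hM
  have hM : (M : ℝ) ≠ 0 := by positivity
  have h4 := sum_binomSq_mul_legendreCoeff M n
  rw [← Finset.sum_mul] at h4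
  rw [eq_div_of_mul_eq h0 h4]
  field_simp

/-- Parseval's identity for `(2 / π) K` and a function with Legendre moments `s n * f n`. -/
theorem hasSum_binomSq_mul_of_summable {f s : ℕ → ℝ} (hf : ∀ n, 0 ≤ f n) (hs : ∀ n, |s n| ≤ 1)
    (hsum : Summable fun n => f n / (2 * n + 1)) :
    HasSum (fun N => binomSq N *
        ∑ n ∈ Finset.range (N + 1), s n * (2 * n + 1) * legendreCoeff N n * f n)
      (4 / Real.pi * ∑' n, s n * (f n / (2 * n + 1))) := by
  set F : ℕ × ℕ → ℝ := fun p =>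
    s p.1 * (2 * p.1 + 1) * f p.1 * (binomSq p.2 * legendreCoeff p.2 p.1) with hF
  set G : ℕ × ℕ → ℝ := fun p =>
    (2 * p.1 + 1) * f p.1 * (binomSq p.2 * legendreCoeff p.2 p.1) with hG
  have hpos : ∀ p : ℕ × ℕ, 0 ≤ binomSq p.2 * legendreCoeff p.2 p.1 := fun p =>
    mul_nonneg (binomSq_nonneg _) (legendreCoeff_nonneg _ _)
  have hG0 : ∀ p, 0 ≤ G p := fun p =>
    mul_nonneg (mul_nonneg (by positivity) (hf p.1)) (hpos p)
  have hval : ∀ (c : ℝ) (n : ℕ), (2 * (n : ℝ) + 1) * c * (4 / Real.pi / (2 * n + 1) ^ 2) =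
      4 / Real.pi * (c / (2 * n + 1)) := fun c n => by
    have : (2 * (n : ℝ) + 1) ≠ 0 := by positivity
    field_simp
  -- `G` is nonnegative, so its summability may be checked by summing over `N` first; it dominates
  -- `F` and thereby justifies the interchange of the two summations.
  have hGs : Summable G := by
    have hfib : ∀ n, HasSum (fun N => G (n, N)) (4 / Real.pi * (f n / (2 * n + 1))) := fun n => by
      rw [← hval]
      exact (hasSum_binomSq_mul_legendreCoeff n).mul_left ((2 * (n : ℝ) + 1) * f n)
    refine (summable_prod_of_nonneg hG0).mpr ⟨fun n => (hfib n).summable, ?_⟩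
    simp only [(hfib _).tsum_eq]
    exact hsum.mul_left (4 / Real.pi)
  have hFs : Summable F := by
    refine Summable.of_norm_bounded hGs fun p => ?_
    have : F p = s p.1 * G p := by simp only [hF, hG]; ring
    rw [this, Real.norm_eq_abs, abs_mul, abs_of_nonneg (hG0 p)]
    exact mul_le_of_le_one_left (hG0 p) (hs _)
  have h1 : HasSum (fun n => s n * (2 * n + 1) * f n * (4 / Real.pi / (2 * n + 1) ^ 2))
      (∑' p, F p) :=
    hFs.hasSum.prod_fiberwise fun n =>
      (hasSum_binomSq_mul_legendreCoeff n).mul_left (s n * (2 * (n : ℝ) + 1) * f n)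
  have h2 : ∑' p, F p = 4 / Real.pi * ∑' n, s n * (f n / (2 * n + 1)) := by
    rw [← h1.tsum_eq, ← tsum_mul_left]
    refine tsum_congr fun n => ?_
    linear_combination s n * hval (f n) n
  have h3 : HasSum (F ∘ Prod.swap) (∑' p, F p) :=
    (Equiv.hasSum_iff (Equiv.prodComm ℕ ℕ)).mpr hFs.hasSum
  rw [← h2]
  refine h3.prod_fiberwise fun N => ?_
  rw [Finset.mul_sum]
  have h4 : ∀ n, (F ∘ Prod.swap) (N, n) =
      binomSq N * (s n * (2 * n + 1) * legendreCoeff N n * f n) := fun n => by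
    simp only [hF, Function.comp, Prod.swap]; ring
  simp only [h4]
  refine hasSum_sum_of_ne_finset_zero fun n hn => ?_
  rw [legendreCoeff_eq_zero (by simpa using hn)]
  ring

/-! ### The two explicit formulas -/

theorem doubleTerm_nonneg (m k n : ℕ) : 0 ≤ doubleTerm m k n :=
  div_nonneg (mul_nonneg (mhs_nonneg _ _) (mhsStar_nonneg _ _)) (by positivity)

theorem one_le_harmonic_succ (n : ℕ) : (1 : ℝ) ≤ harmonic (n + 1) := by
  simpa using harmonic_cast_mono (Nat.succ_le_succ (Nat.zero_le n))

theorem summable_doubleTerm_succ {m k : ℕ} (hk : k ∈ Finset.Icc 1 m) :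
    Summable fun n : ℕ => doubleTerm m k (n + 1) := by
  have hk' := Finset.mem_Icc.mp hk
  have h := ((summable_nat_add_iff 2).mpr (summable_harmonic_pow_div_sq m)).mul_left 2
  refine h.of_nonneg_of_le (fun n => doubleTerm_nonneg _ _ _) fun n => ?_
  have hH := one_le_harmonic_succ (n + 1)
  have hnum : mhs (ones (k - 1)) n * mhsStar (ones (m - k)) (n + 2) ≤
      (harmonic (n + 2) : ℝ) ^ m := by
    calc _ ≤ (harmonic (n + 2) : ℝ) ^ (k - 1) * (harmonic (n + 2) : ℝ) ^ (m - k) :=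
          mul_le_mul ((mhs_ones_le _ _).trans (pow_le_pow_left₀ (harmonic_cast_nonneg _)
            (harmonic_cast_mono (by omega)) _)) (mhsStar_ones_le _ _) (mhsStar_nonneg _ _)
            (pow_nonneg (harmonic_cast_nonneg _) _)
      _ ≤ _ := by
        rw [← pow_add]
        exact pow_le_pow_right₀ hH (by omega)
  have hpow : (0 : ℝ) ≤ (harmonic (n + 2) : ℝ) ^ m := pow_nonneg (harmonic_cast_nonneg _) _
  simp only [doubleTerm]
  rw [mul_div_assoc', Nat.add_sub_cancel]
  push_cast
  rw [div_le_div_iff₀ (by positivity) (by positivity)]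
  have hn : (0 : ℝ) ≤ n := Nat.cast_nonneg n
  calc _ ≤ (harmonic (n + 2) : ℝ) ^ m * ((n : ℝ) + 2 + 1) ^ 2 :=
        mul_le_mul_of_nonneg_right hnum (by positivity)
    _ ≤ (harmonic (n + 2) : ℝ) ^ m *
        (2 * (((n : ℝ) + 1) * ((n : ℝ) + 1 + 1) * (2 * ((n : ℝ) + 1) + 1))) := by
        refine mul_le_mul_of_nonneg_left ?_ hpow
        nlinarith [mul_nonneg hn hn, mul_nonneg hn (mul_nonneg hn hn)]
    _ = _ := by ring

theorem summable_sign_mul_doubleTerm_succ {m k : ℕ} (hk : k ∈ Finset.Icc 1 m) {s : ℕ → ℝ}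
    (hs : ∀ n, |s n| ≤ 1) : Summable fun n : ℕ => s (n + 1) * doubleTerm m k (n + 1) := by
  refine Summable.of_norm_bounded (summable_doubleTerm_succ hk) fun n => ?_
  rw [Real.norm_eq_abs, abs_mul, abs_of_nonneg (doubleTerm_nonneg _ _ _)]
  exact mul_le_of_le_one_left (doubleTerm_nonneg _ _ _) (hs _)

theorem coeff_legendreGen_succ_div (m n : ℕ) :
    coeff m (legendreGen (n + 1)) / (2 * ((n + 1 : ℕ) : ℝ) + 1) =
      ∑ k ∈ Finset.Icc 1 m, doubleTerm m k (n + 1) := by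
  rw [coeff_legendreGen_succ, Finset.sum_div]
  refine Finset.sum_congr rfl fun k _ => ?_
  rw [div_div, doubleTerm]
  push_cast
  rfl

theorem summable_coeff_legendreGen_div (m : ℕ) :
    Summable fun n : ℕ => coeff m (legendreGen n) / (2 * (n : ℝ) + 1) := by
  rw [← summable_nat_add_iff 1]
  simp only [coeff_legendreGen_succ_div]
  exact summable_sum fun k hk => summable_doubleTerm_succ hk

theorem summable_sign_mul_coeff_legendreGen_div (m : ℕ) {s : ℕ → ℝ} (hs : ∀ n, |s n| ≤ 1) :
    Summable fun n : ℕ => s n * (coeff m (legendreGen n) / (2 * (n : ℝ) + 1)) := by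
  refine Summable.of_norm_bounded (summable_coeff_legendreGen_div m) fun n => ?_
  have h0 : 0 ≤ coeff m (legendreGen n) / (2 * (n : ℝ) + 1) :=
    div_nonneg (coeff_legendreGen_nonneg _ _) (by positivity)
  rw [Real.norm_eq_abs, abs_mul, abs_of_nonneg h0]
  exact mul_le_of_le_one_left h0 (hs _)

theorem tsum_sign_mul_coeff_legendreGen_div (m : ℕ) {s : ℕ → ℝ} (hs : ∀ n, |s n| ≤ 1)
    (hs0 : s 0 = 1) :
    ∑' n : ℕ, s n * (coeff m (legendreGen n) / (2 * (n : ℝ) + 1)) =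
      1 + ∑ k ∈ Finset.Icc 1 m, ∑' n : ℕ+, doubleTerm m k n * s n := by
  rw [(summable_sign_mul_coeff_legendreGen_div m hs).tsum_eq_zero_add, hs0,
    coeff_legendreGen_zero]
  simp only [coeff_legendreGen_succ_div, Finset.mul_sum]
  rw [Summable.tsum_finsetSum fun k hk => summable_sign_mul_doubleTerm_succ hk hs]
  congr 1
  · simp
  · refine Finset.sum_congr rfl fun k _ => ?_
    rw [tsum_pnat_eq_tsum_succ (f := fun n => doubleTerm m k n * s n)]
    exact tsum_congr fun n => mul_comm _ _

theorem hasSum_binomSq_div_pow (m : ℕ) :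
    HasSum (fun N : ℕ => binomSq N * (1 / ((N : ℝ) + 1) ^ (m + 1)))
      (4 / Real.pi * ∑' n : ℕ, (-1) ^ n * (coeff m (legendreGen n) / (2 * (n : ℝ) + 1))) := by
  have h := hasSum_binomSq_mul_of_summable (coeff_legendreGen_nonneg m)
    (s := fun n => (-1) ^ n) (fun n => by simp) (summable_coeff_legendreGen_div m)
  refine h.congr_fun fun N => ?_
  have h2 := congrArg (coeff m) (sum_alternating_legendreGen N)
  rw [coeff_geomInv, inv_pow, ← one_div] at h2
  rw [← h2, map_sum]
  congr 1
  refine Finset.sum_congr rfl fun n _ => ?_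
  have : ((-1) ^ n * (2 * (n : ℝ⟦X⟧) + 1) * C (legendreCoeff N n) : ℝ⟦X⟧) =
      C ((-1) ^ n * (2 * (n : ℝ) + 1) * legendreCoeff N n) := by simp [C_two]
  rw [this, coeff_C_mul]

theorem hasSum_binomSq_mul_mhsStar (m : ℕ) :
    HasSum (fun N : ℕ => binomSq N * (mhsStar (ones m) (N + 1) / ((N : ℝ) + 1)))
      (4 / Real.pi * ∑' n : ℕ, coeff m (legendreGen n) / (2 * (n : ℝ) + 1)) := by
  have h := hasSum_binomSq_mul_of_summable (coeff_legendreGen_nonneg m)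
    (s := fun _ => 1) (fun n => by simp) (summable_coeff_legendreGen_div m)
  simp only [one_mul] at h
  refine h.congr_fun fun N => ?_
  have h2 := congrArg (coeff m) (sum_legendreGen N)
  rw [coeff_C_mul, coeff_mhsStarGen, inv_mul_eq_div] at h2
  rw [← h2, map_sum]
  congr 1
  refine Finset.sum_congr rfl fun n _ => ?_
  have : ((2 * (n : ℝ⟦X⟧) + 1) * C (legendreCoeff N n) : ℝ⟦X⟧) =
      C ((2 * (n : ℝ) + 1) * legendreCoeff N n) := by simp [C_two]
  rw [this, coeff_C_mul]

end Parseval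

section Words

open PowerSeries

/-! ### Spans of colored multiple harmonic sums -/

/-- The `ℚ`-span of the truncations `n ↦ cmzvPartial w n`, as functions of `n`, for `w ∈ S`. -/
noncomputable def partialSpan (S : Set (List (ℕ × ℂ))) : Submodule ℚ (ℕ → ℂ) :=
  Submodule.span ℚ (cmzvPartial '' S)

/-- The words with letters in `A`. -/
def wordsIn (A : Set (ℕ × ℂ)) : Set (List (ℕ × ℂ)) := {w | ∀ p ∈ w, p ∈ A}

/-- Summation against the letter `p = (k, z)`. On truncations, this prepends `p` to the word. -/
noncomputable def prependLetter (p : ℕ × ℂ) : (ℕ → ℂ) →ₗ[ℚ] (ℕ → ℂ) where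
  toFun g n := ∑ j ∈ Finset.Icc 1 n, p.2 ^ j / (j : ℂ) ^ p.1 * g (j - 1)
  map_add' g h := by
    funext n
    simp [mul_add, Finset.sum_add_distrib]
  map_smul' c g := by
    funext n
    simp [Finset.smul_sum]

theorem prependLetter_apply (p : ℕ × ℂ) (g : ℕ → ℂ) (n : ℕ) :
    prependLetter p g n = ∑ j ∈ Finset.Icc 1 n, p.2 ^ j / (j : ℂ) ^ p.1 * g (j - 1) := rfl

theorem prependLetter_succ (p : ℕ × ℂ) (g : ℕ → ℂ) (n : ℕ) :
    prependLetter p g (n + 1) =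
      prependLetter p g n + p.2 ^ (n + 1) / ((n : ℂ) + 1) ^ p.1 * g n := by
  rw [prependLetter_apply, Finset.sum_Icc_succ_top (by omega), prependLetter_apply]
  simp

theorem prependLetter_mem {S S' : Set (List (ℕ × ℂ))} {p : ℕ × ℂ} (h : ∀ w ∈ S, p :: w ∈ S')
    {g : ℕ → ℂ} (hg : g ∈ partialSpan S) : prependLetter p g ∈ partialSpan S' := by
  have h1 : (partialSpan S).map (prependLetter p) ≤ partialSpan S' := by
    rw [partialSpan, Submodule.map_span, Submodule.span_le]
    rintro _ ⟨_, ⟨w, hw, rfl⟩, rfl⟩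
    exact Submodule.subset_span ⟨p :: w, h w hw, rfl⟩
  exact h1 (Submodule.mem_map_of_mem hg)

theorem one_mem_partialSpan_wordsIn (A : Set (ℕ × ℂ)) :
    (fun _ => 1 : ℕ → ℂ) ∈ partialSpan (wordsIn A) :=
  Submodule.subset_span ⟨[], by simp [wordsIn], rfl⟩

/-- The power series `1 + ∑_{k ≥ 1} c_k X ^ k / n ^ k`, where `c = e` for even `n` and `c = o`
for odd `n`. -/
noncomputable def parityFactor (e o : ℕ → ℚ) (n : ℕ) : ℝ⟦X⟧ :=
  PowerSeries.mk fun k => if k = 0 then 1 else ((if Even n then e k else o k : ℚ) : ℝ) / (n : ℝ) ^ k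

/-- The product of the factors `parityFactor e o j` over `1 ≤ j ≤ n`. -/
noncomputable def parityProd (e o : ℕ → ℚ) : ℕ → ℝ⟦X⟧
  | 0 => 1
  | n + 1 => parityProd e o n * parityFactor e o (n + 1)

theorem coeff_parityProd_succ (e o : ℕ → ℚ) (m n : ℕ) :
    coeff m (parityProd e o (n + 1)) = coeff m (parityProd e o n) +
      ∑ k ∈ Finset.Icc 1 m, ((if Even (n + 1) then e k else o k : ℚ) : ℝ) / ((n : ℝ) + 1) ^ k *
        coeff (m - k) (parityProd e o n) := by
  rw [parityProd, mul_comm, coeff_mul, Finset.Nat.sum_antidiagonal_eq_sum_range_succ_mk,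
    Finset.sum_range_eq_add_Ico _ (Nat.succ_pos m)]
  congr 1
  · simp [parityFactor]
  · rw [show Finset.Ico 1 m.succ = Finset.Icc 1 m by
      ext; simp only [Finset.mem_Icc, Finset.mem_Ico]; omega]
    refine Finset.sum_congr rfl fun k hk => ?_
    have : k ≠ 0 := by have := (Finset.mem_Icc.mp hk).1; omega
    simp only [parityFactor, coeff_mk, this, if_false]
    push_cast
    rfl

theorem parity_eq_add_mul_neg_one_pow (a b : ℚ) (n : ℕ) :
    (((if Even n then a else b : ℚ) : ℝ) : ℂ) =
      (((a + b) / 2 : ℚ) : ℂ) * 1 ^ n + (((a - b) / 2 : ℚ) : ℂ) * (-1) ^ n := by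
  by_cases h : Even n
  · simp [h]
    ring
  · simp [h, (Nat.not_even_iff_odd.mp h).neg_one_pow]
    ring

/-- Multiplying out, the coefficients of a product over the integers `j ≤ n` are combinations of
colored multiple harmonic sums. The parity of `j` is detected by `(-1) ^ j`. -/
theorem coeff_parityProd_mem {e o : ℕ → ℚ} {A : Set (ℕ × ℂ)}
    (h1 : ∀ k, 1 ≤ k → e k + o k ≠ 0 → (k, (1 : ℂ)) ∈ A)
    (h2 : ∀ k, 1 ≤ k → (k, (-1 : ℂ)) ∈ A) (m : ℕ) :
    (fun n => ((coeff m (parityProd e o n) : ℝ) : ℂ)) ∈ partialSpan (wordsIn A) := by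
  induction m using Nat.strong_induction_on with
  | _ m ih =>
  have hcons : ∀ p ∈ A, ∀ w ∈ wordsIn A, p :: w ∈ wordsIn A := fun p hp w hw q hq => by
    rcases List.mem_cons.mp hq with rfl | hq
    exacts [hp, hw q hq]
  set c : ℕ → ℕ → ℂ := fun i n => ((coeff i (parityProd e o n) : ℝ) : ℂ) with hc
  have key : c m = (if m = 0 then 1 else 0 : ℚ) • (fun _ => 1 : ℕ → ℂ) +
      ∑ k ∈ Finset.Icc 1 m, (((e k + o k) / 2) • prependLetter (k, 1) (c (m - k)) +
        ((e k - o k) / 2) • prependLetter (k, -1) (c (m - k))) := by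
    funext n
    induction n with
    | zero =>
      rw [Pi.add_apply, Finset.sum_apply, Finset.sum_eq_zero]
      · by_cases hm : m = 0 <;> simp [hc, parityProd, coeff_one, hm]
      · intro k _
        simp [prependLetter_apply]
    | succ n ihn =>
      have h3 : c m (n + 1) = c m n + ∑ k ∈ Finset.Icc 1 m,
          (((if Even (n + 1) then e k else o k : ℚ) : ℝ) : ℂ) / ((n : ℂ) + 1) ^ k *
            c (m - k) n := by
        simp only [hc]
        rw [coeff_parityProd_succ]
        push_cast
        rfl
      rw [h3, ihn]
      simp only [Pi.add_apply, Finset.sum_apply, Pi.smul_apply, prependLetter_succ]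
      rw [add_assoc, ← Finset.sum_add_distrib]
      congr 1
      refine Finset.sum_congr rfl fun k _ => ?_
      rw [parity_eq_add_mul_neg_one_pow]
      simp only [Rat.smul_def]
      ring
  change c m ∈ _
  rw [key]
  refine add_mem (Submodule.smul_mem _ _ (one_mem_partialSpan_wordsIn A))
    (sum_mem fun k hk => add_mem ?_ (Submodule.smul_mem _ _ ?_))
  · have hk' := Finset.mem_Icc.mp hk
    by_cases hz : e k + o k = 0
    · simp [hz]
    · exact Submodule.smul_mem _ _ (prependLetter_mem (hcons _ (h1 k hk'.1 hz))
        (ih _ (by omega)))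
  · have hk' := Finset.mem_Icc.mp hk
    exact prependLetter_mem (hcons _ (h2 k hk'.1)) (ih _ (by omega))

/-! ### Convergence of admissible sums -/

/-- Summation by parts. -/
theorem one_sub_mul_sum_pow_mul (z : ℂ) (c : ℕ → ℂ) (n : ℕ) :
    (1 - z) * ∑ j ∈ Finset.range (n + 1), z ^ (j + 1) * c j =
      z * c 0 + ∑ j ∈ Finset.range n, z ^ (j + 2) * (c (j + 1) - c j) - z ^ (n + 2) * c n := by
  induction n with
  | zero => simp; ring
  | succ n ih =>
    rw [Finset.sum_range_succ, mul_add, ih, Finset.sum_range_succ _ n]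
    ring

/-- Dirichlet's test on the closed unit disc, for a coefficient sequence of bounded variation. -/
theorem exists_tendsto_sum_pow_mul {z : ℂ} (hz : ‖z‖ ≤ 1) (hz1 : z ≠ 1) {c : ℕ → ℂ}
    (hc : Tendsto c atTop (𝓝 0)) (hv : Summable fun j => ‖c (j + 1) - c j‖) :
    ∃ x, Tendsto (fun n => ∑ j ∈ Finset.range n, z ^ (j + 1) * c j) atTop (𝓝 x) := by
  have hs : Summable fun j => z ^ (j + 2) * (c (j + 1) - c j) := by
    refine Summable.of_norm_bounded hv fun j => ?_
    rw [norm_mul, norm_pow]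
    exact mul_le_of_le_one_left (norm_nonneg _) (pow_le_one₀ (norm_nonneg _) hz)
  have h0 : Tendsto (fun n => z ^ (n + 2) * c n) atTop (𝓝 0) := by
    refine squeeze_zero_norm (fun n => ?_) (tendsto_zero_iff_norm_tendsto_zero.mp hc)
    rw [norm_mul, norm_pow]
    exact mul_le_of_le_one_left (norm_nonneg _) (pow_le_one₀ (norm_nonneg _) hz)
  have h1 : 1 - z ≠ 0 := sub_ne_zero.mpr hz1.symm
  have h2 := ((hs.hasSum.tendsto_sum_nat.const_add (z * c 0)).sub h0).const_mul (1 - z)⁻¹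
  refine ⟨_, (tendsto_add_atTop_iff_nat 1).mp (h2.congr fun n => ?_)⟩
  rw [← one_sub_mul_sum_pow_mul, inv_mul_cancel_left₀ h1]

theorem cmzvPartial_cons_eq_sum_range (p : ℕ × ℂ) (w : List (ℕ × ℂ)) (n : ℕ) :
    cmzvPartial (p :: w) n =
      ∑ j ∈ Finset.range n, p.2 ^ (j + 1) / ((j : ℂ) + 1) ^ p.1 * cmzvPartial w j := by
  rw [cmzvPartial, Finset.range_eq_Ico, show Finset.Icc 1 n = Finset.Ico (0 + 1) (n + 1) by
      ext; simp only [Finset.mem_Icc, Finset.mem_Ico]; omega, ← Finset.sum_Ico_add']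
  simp

theorem norm_natCast_add_one (n : ℕ) : ‖(n : ℂ) + 1‖ = (n : ℝ) + 1 := by
  rw [← Nat.cast_succ, Complex.norm_natCast, Nat.cast_succ]

theorem norm_cmzvPartial_cons_sub_le (p : ℕ × ℂ) (w : List (ℕ × ℂ)) (hp : 1 ≤ p.1 ∧ ‖p.2‖ ≤ 1)
    (hw : ∀ q ∈ w, 1 ≤ q.1 ∧ ‖q.2‖ ≤ 1) (n : ℕ) :
    ‖cmzvPartial (p :: w) (n + 1) - cmzvPartial (p :: w) n‖ ≤
      (harmonic n : ℝ) ^ w.length / ((n : ℝ) + 1) ^ p.1 := by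
  rw [cmzvPartial_cons_eq_sum_range, cmzvPartial_cons_eq_sum_range, Finset.sum_range_succ,
    add_sub_cancel_left, norm_mul, norm_div, norm_pow, norm_pow, norm_natCast_add_one,
    div_mul_eq_mul_div]
  refine div_le_div_of_nonneg_right ?_ (by positivity)
  exact (mul_le_of_le_one_left (norm_nonneg _) (pow_le_one₀ (norm_nonneg _) hp.2)).trans
    (norm_cmzvPartial_le w hw n)

/-- An admissible sum converges absolutely if its first exponent is at least `2`; otherwise its
first root of unity is not `1`, and Dirichlet's test applies. -/
theorem exists_tendsto_cmzvPartial {N : ℕ} (hN : 1 ≤ N) {w : List (ℕ × ℂ)}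
    (hw : CMZVAdmissible N w) : ∃ x, Tendsto (cmzvPartial w) atTop (𝓝 x) := by
  obtain ⟨hw1, hw2⟩ := hw
  replace hw1 : ∀ p ∈ w, 1 ≤ p.1 ∧ ‖p.2‖ ≤ 1 := fun p hp =>
    ⟨(hw1 p hp).1, (Complex.norm_eq_one_of_pow_eq_one (hw1 p hp).2 (by omega)).le⟩
  cases w with
  | nil => exact ⟨1, tendsto_const_nhds⟩
  | cons p w =>
    have hp := hw1 p (by simp)
    have hp1 : p ≠ (1, 1) := hw2 p (by simp)
    have hw : ∀ q ∈ w, 1 ≤ q.1 ∧ ‖q.2‖ ≤ 1 := fun q hq => hw1 q (by simp [hq])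
    rcases Nat.lt_or_ge 1 p.1 with hk | hk
    · have hs : Summable fun j : ℕ =>
          p.2 ^ (j + 1) / ((j : ℂ) + 1) ^ p.1 * cmzvPartial w j := by
        refine Summable.of_norm_bounded (summable_harmonic_pow_div_sq w.length) fun j => ?_
        have hj : (1 : ℝ) ≤ (j : ℝ) + 1 := by linarith [(Nat.cast_nonneg j : (0 : ℝ) ≤ j)]
        have h := norm_cmzvPartial_cons_sub_le p w hp hw j
        rw [cmzvPartial_cons_eq_sum_range, cmzvPartial_cons_eq_sum_range, Finset.sum_range_succ,
          add_sub_cancel_left] at h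
        exact h.trans (div_le_div_of_nonneg_left (pow_nonneg (harmonic_cast_nonneg _) _)
          (by positivity) (pow_le_pow_right₀ hj hk))
      exact ⟨_, hs.hasSum.tendsto_sum_nat.congr fun n =>
        (cmzvPartial_cons_eq_sum_range p w n).symm⟩
    · obtain ⟨k, z⟩ := p
      obtain rfl : k = 1 := le_antisymm hk hp.1
      have hz : z ≠ 1 := fun h => hp1 (by rw [h])
      have hW := norm_cmzvPartial_le w hw
      have hc : Tendsto (fun j : ℕ => cmzvPartial w j / ((j : ℂ) + 1)) atTop (𝓝 0) := by
        refine squeeze_zero_norm (fun j => ?_) (tendsto_harmonic_pow_div w.length)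
        rw [norm_div, norm_natCast_add_one]
        exact div_le_div_of_nonneg_right (hW j) (by positivity)
      have hvar : ∃ r : ℕ, ∀ j : ℕ, ‖cmzvPartial w (j + 1) - cmzvPartial w j‖ ≤
          (harmonic j : ℝ) ^ r / ((j : ℝ) + 1) := by
        cases w with
        | nil =>
          refine ⟨0, fun j => ?_⟩
          simp only [cmzvPartial, sub_self, norm_zero]
          positivity
        | cons q w =>
          have hq := hw q (by simp)
          refine ⟨w.length, fun j => ?_⟩
          have hj : (1 : ℝ) ≤ (j : ℝ) + 1 := by linarith [(Nat.cast_nonneg j : (0 : ℝ) ≤ j)]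
          exact (norm_cmzvPartial_cons_sub_le q w hq (fun p hp => hw p (by simp [hp])) j).trans
            (div_le_div_of_nonneg_left (pow_nonneg (harmonic_cast_nonneg _) _) (by positivity)
              (le_self_pow₀ hj (by omega)))
      obtain ⟨r, hr⟩ := hvar
      have hv : Summable fun j : ℕ => ‖cmzvPartial w (j + 1) / (((j + 1 : ℕ) : ℂ) + 1) -
          cmzvPartial w j / ((j : ℂ) + 1)‖ := by
        refine ((summable_harmonic_pow_div_sq r).add
          (summable_harmonic_pow_div_sq w.length)).of_nonneg_of_le (fun j => norm_nonneg _)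
          fun j => ?_
        have h1 : (j : ℂ) + 1 ≠ 0 := by exact_mod_cast Nat.succ_ne_zero j
        have h2 : ((j + 1 : ℕ) : ℂ) + 1 ≠ 0 := by exact_mod_cast Nat.succ_ne_zero (j + 1)
        have h3 : cmzvPartial w (j + 1) / (((j + 1 : ℕ) : ℂ) + 1) -
            cmzvPartial w j / ((j : ℂ) + 1) =
            (cmzvPartial w (j + 1) - cmzvPartial w j) / (((j + 1 : ℕ) : ℂ) + 1) -
              cmzvPartial w j / (((j : ℂ) + 1) * (((j + 1 : ℕ) : ℂ) + 1)) := by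
          field_simp
          push_cast
          ring
        have hj : (0 : ℝ) ≤ j := Nat.cast_nonneg j
        rw [h3]
        refine (norm_sub_le _ _).trans (add_le_add ?_ ?_)
        · rw [norm_div, norm_natCast_add_one]
          calc _ ≤ (harmonic j : ℝ) ^ r / ((j : ℝ) + 1) / ((j : ℝ) + 1) := by
                refine div_le_div₀ (div_nonneg (pow_nonneg (harmonic_cast_nonneg _) _)
                  (by positivity)) (hr j) (by positivity) ?_
                push_cast
                linarith
            _ = _ := by rw [div_div, sq]
        · rw [norm_div, norm_mul, norm_natCast_add_one, norm_natCast_add_one]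
          refine div_le_div₀ (pow_nonneg (harmonic_cast_nonneg _) _) (hW j) (by positivity) ?_
          push_cast
          nlinarith
      obtain ⟨x, hx⟩ := exists_tendsto_sum_pow_mul hp.2 hz hc hv
      refine ⟨x, hx.congr fun n => ?_⟩
      rw [cmzvPartial_cons_eq_sum_range]
      refine Finset.sum_congr rfl fun j _ => ?_
      rw [pow_one, mul_div_assoc', div_mul_eq_mul_div]

theorem exists_tendsto_of_mem_partialSpan {N : ℕ} (hN : 1 ≤ N) {g : ℕ → ℂ}
    (hg : g ∈ partialSpan {w | CMZVAdmissible N w}) :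
    ∃ x ∈ CMZVle N, Tendsto g atTop (𝓝 x) := by
  refine Submodule.span_induction ?_ ?_ ?_ ?_ hg
  · rintro _ ⟨w, hw, rfl⟩
    obtain ⟨x, hx⟩ := exists_tendsto_cmzvPartial hN hw
    exact ⟨x, Submodule.subset_span ⟨N, hN, le_rfl, w, hw, hx⟩, hx⟩
  · exact ⟨0, zero_mem _, tendsto_const_nhds⟩
  · rintro g h _ _ ⟨x, hx, hgx⟩ ⟨y, hy, hhy⟩
    exact ⟨x + y, add_mem hx hy, hgx.add hhy⟩
  · rintro c g _ ⟨x, hx, hgx⟩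
    exact ⟨c • x, Submodule.smul_mem _ c hx, hgx.const_smul c⟩

/-- Real limits of combinations of admissible sums. -/
theorem exists_real_tendsto_of_mem_partialSpan {N : ℕ} (hN : 1 ≤ N) {r : ℕ → ℝ}
    (hr : (fun n => (r n : ℂ)) ∈ partialSpan {w | CMZVAdmissible N w}) :
    ∃ y : ℝ, (y : ℂ) ∈ CMZVle N ∧ Tendsto r atTop (𝓝 y) := by
  obtain ⟨x, hx, hlim⟩ := exists_tendsto_of_mem_partialSpan hN hr
  have h1 : Tendsto r atTop (𝓝 x.re) := by
    simpa [Function.comp_def] using (Complex.continuous_re.tendsto x).comp hlim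
  have h2 : Tendsto (fun n => (r n : ℂ)) atTop (𝓝 (x.re : ℂ)) :=
    (Complex.continuous_ofReal.tendsto _).comp h1
  rw [tendsto_nhds_unique hlim h2] at hx
  exact ⟨x.re, hx, h1⟩

theorem partialSpan_mono {S T : Set (List (ℕ × ℂ))} (h : S ⊆ T) : partialSpan S ≤ partialSpan T :=
  Submodule.span_mono (Set.image_mono h)

theorem one_mem_CMZVle {N : ℕ} (hN : 1 ≤ N) : (1 : ℂ) ∈ CMZVle N :=
  Submodule.subset_span ⟨N, hN, le_rfl, [], by simp [CMZVAdmissible], tendsto_const_nhds⟩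

end Words

section Gauss

open PowerSeries
open scoped PowerSeries.WithPiTopology

/-! ### Gauss' summation in the ring of power series -/

theorem one_sub_mul_mk_pow (a : ℝ) :
    (1 - C a * X) * (PowerSeries.mk fun k => a ^ k) = 1 := by
  ext k
  cases k with
  | zero => simp [sub_mul]
  | succ k =>
    rw [sub_mul, one_mul, mul_assoc, map_sub, coeff_C_mul, coeff_succ_X_mul, coeff_mk, coeff_mk,
      coeff_one, pow_succ']
    simp

theorem one_sub_sq_mul_mk_succ_mul_pow (a : ℝ) :
    (1 - C a * X) ^ 2 * (PowerSeries.mk fun k => ((k : ℝ) + 1) * a ^ k) = 1 := by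
  have h : (1 - C a * X) * (PowerSeries.mk fun k => ((k : ℝ) + 1) * a ^ k) =
      PowerSeries.mk fun k => a ^ k := by
    ext k
    cases k with
    | zero => simp [sub_mul]
    | succ k =>
      rw [sub_mul, one_mul, mul_assoc, map_sub, coeff_C_mul, coeff_succ_X_mul, coeff_mk, coeff_mk,
        coeff_mk]
      push_cast
      ring
  rw [sq, mul_assoc, h, one_sub_mul_mk_pow]

/-- `0 ≤ P ≤ Q` coefficient by coefficient. -/
def CoeffLE (P Q : ℝ⟦X⟧) : Prop := ∀ k, 0 ≤ coeff k P ∧ coeff k P ≤ coeff k Q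

theorem CoeffLE.mul {P Q P' Q' : ℝ⟦X⟧} (h : CoeffLE P Q) (h' : CoeffLE P' Q') :
    CoeffLE (P * P') (Q * Q') := fun k => by
  rw [coeff_mul, coeff_mul]
  exact ⟨Finset.sum_nonneg fun p _ => mul_nonneg (h _).1 (h' _).1,
    Finset.sum_le_sum fun p _ => mul_le_mul (h _).2 (h' _).2 (h' _).1 ((h _).1.trans (h _).2)⟩

theorem CoeffLE.C_mul {P Q : ℝ⟦X⟧} (h : CoeffLE P Q) {a : ℝ} (ha : 0 ≤ a) :
    CoeffLE (C a * P) (C a * Q) := fun k => by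
  rw [coeff_C_mul, coeff_C_mul]
  exact ⟨mul_nonneg ha (h k).1, mul_le_mul_of_nonneg_left (h k).2 ha⟩

theorem coeffLE_geomInv {a b : ℝ} (ha : 0 < a) (hab : a ≤ b) :
    CoeffLE (geomInv b) (geomInv a) := fun k => by
  have hb := ha.trans_le hab
  rw [coeff_geomInv, coeff_geomInv]
  exact ⟨by positivity, pow_le_pow_left₀ (by positivity) (inv_anti₀ ha hab) _⟩

/-- The power series `N! / ∏_{i ≤ N} (M + 1 + i - X)`. -/
noncomputable def invRising (M : ℕ) : ℕ → ℝ⟦X⟧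
  | 0 => geomInv ((M : ℝ) + 1)
  | N + 1 => invRising M N * (C ((N : ℝ) + 1) * geomInv ((M : ℝ) + N + 2))

theorem sub_X_mul_geomInv_add_two (M N : ℕ) :
    ((M : ℝ⟦X⟧) + (N : ℝ⟦X⟧) + 2 - (X : ℝ⟦X⟧)) * geomInv ((M : ℝ) + N + 2) = 1 := by
  have h := sub_X_mul_geomInv (c := (M : ℝ) + N + 2) (by positivity)
  simpa only [map_add, map_natCast, C_two] using h

theorem sub_X_mul_geomInv_add_one (M : ℕ) :
    ((M : ℝ⟦X⟧) + 1 - X) * geomInv ((M : ℝ) + 1) = 1 := by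
  have h := sub_X_mul_geomInv (c := (M : ℝ) + 1) (by positivity)
  simpa only [map_add, map_natCast, map_one] using h

theorem invRising_succ_left_mul (M N : ℕ) :
    invRising (M + 1) N = invRising M N * ((M : ℝ⟦X⟧) + 1 - X) * geomInv ((M : ℝ) + N + 2) := by
  induction N with
  | zero =>
    have h := sub_X_mul_geomInv_add_one M
    simp only [invRising, Nat.cast_zero, add_zero]
    rw [mul_comm (geomInv _), h, one_mul]
    congr 1
    push_cast
    ring
  | succ N ih =>
    rw [invRising, ih, invRising]
    push_cast
    rw [show (M : ℝ) + 1 + N + 2 = M + (N + 1) + 2 by ring]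
    ring

theorem invRising_zero_left (N : ℕ) :
    invRising 0 N = C (((N : ℝ) + 1)⁻¹) * mhsStarGen (N + 1) := by
  induction N with
  | zero => simp [invRising, mhsStarGen]
  | succ N ih =>
    have h1 := C_inv_mul_natCast N
    have h2 := C_inv_mul_natCast (N + 1)
    rw [invRising, ih, mhsStarGen.eq_2 (N + 1)]
    push_cast at *
    rw [show (0 : ℝ) + N + 2 = N + 1 + 1 by ring]
    simp only [map_add, map_natCast, map_one] at *
    linear_combination (mhsStarGen (N + 1) * geomInv ((N : ℝ) + 1 + 1)) * (h1 - h2)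

theorem coeffLE_invRising (M N : ℕ) : CoeffLE (C (M : ℝ) * invRising M N) (invRising 0 N) := by
  induction N with
  | zero =>
    intro k
    simp only [invRising, coeff_C_mul, coeff_geomInv, Nat.cast_zero, zero_add, inv_one, one_pow]
    have h1 : (0 : ℝ) ≤ M := Nat.cast_nonneg M
    have h2 : ((M : ℝ) + 1)⁻¹ ≤ 1 := inv_le_one_of_one_le₀ (by linarith)
    refine ⟨by positivity, ?_⟩
    rw [pow_succ', ← mul_assoc]
    refine mul_le_one₀ ?_ (by positivity) (pow_le_one₀ (by positivity) h2)
    rw [← div_eq_mul_inv, div_le_one (by positivity)]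
    linarith
  | succ N ih =>
    rw [invRising, invRising, ← mul_assoc]
    refine ih.mul (CoeffLE.C_mul (coeffLE_geomInv (by positivity) ?_) (by positivity))
    push_cast
    linarith [(Nat.cast_nonneg M : (0 : ℝ) ≤ M)]

theorem coeffLE_invRising_zero_left (M N : ℕ) : CoeffLE (invRising M N) (invRising 0 N) := by
  induction N with
  | zero => exact coeffLE_geomInv (by simp) (by simp)
  | succ N ih =>
    rw [invRising, invRising]
    refine ih.mul (CoeffLE.C_mul (coeffLE_geomInv (by positivity) ?_) (by positivity))
    push_cast
    linarith [(Nat.cast_nonneg M : (0 : ℝ) ≤ M)]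

/-- The general term of the series `₂F₁(1/2, 1/2; M + 2 - X; 1) / (M + 1 - X)`. For `M = 0` its
coefficients are the terms of the second series of the theorem. -/
noncomputable def gaussTerm (M N : ℕ) : ℝ⟦X⟧ := C (binomSq N) * invRising M N

theorem coeff_gaussTerm_zero (m N : ℕ) :
    coeff m (gaussTerm 0 N) = binomSq N * (mhsStar (ones m) (N + 1) / ((N : ℝ) + 1)) := by
  rw [gaussTerm, coeff_C_mul, invRising_zero_left, coeff_C_mul, coeff_mhsStarGen, inv_mul_eq_div]

theorem summable_coeff_gaussTerm_zero (m : ℕ) : Summable fun N => coeff m (gaussTerm 0 N) := by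
  simp only [coeff_gaussTerm_zero]
  exact (hasSum_binomSq_mul_mhsStar m).summable

theorem coeffLE_gaussTerm (M N : ℕ) : CoeffLE (gaussTerm M N) (gaussTerm 0 N) :=
  (coeffLE_invRising_zero_left M N).C_mul (binomSq_nonneg N)

theorem coeffLE_natCast_mul_gaussTerm (M N : ℕ) :
    CoeffLE (C (M : ℝ) * gaussTerm M N) (gaussTerm 0 N) := by
  rw [gaussTerm, mul_left_comm]
  exact (coeffLE_invRising M N).C_mul (binomSq_nonneg N)

theorem summable_gaussTerm (M : ℕ) : Summable (gaussTerm M) :=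
  (WithPiTopology.summable_iff_summable_coeff _).mpr fun m =>
    (summable_coeff_gaussTerm_zero m).of_nonneg_of_le (fun N => (coeffLE_gaussTerm M N m).1)
      fun N => (coeffLE_gaussTerm M N m).2

/-- The difference of the two sides of the contiguity relation between the parameters `M` and
`M + 1` telescopes. -/
theorem gaussTerm_telescope (M N : ℕ) :
    ((M : ℝ⟦X⟧) + 1 - X + C (1 / 2)) ^ 2 * gaussTerm (M + 1) N -
        ((M : ℝ⟦X⟧) + 1 - X) ^ 2 * gaussTerm M N =
      ((M : ℝ⟦X⟧) + 1 - X) *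
        (((N + 1 : ℕ) : ℝ⟦X⟧) * gaussTerm M (N + 1) - (N : ℝ⟦X⟧) * gaussTerm M N) := by
  have h1 : C (binomSq (N + 1)) * ((N : ℝ⟦X⟧) + 1) ^ 2 =
      C (binomSq N) * ((N : ℝ⟦X⟧) + C (1 / 2)) ^ 2 := by
    have h := congrArg (C : ℝ →+* ℝ⟦X⟧) (binomSq_succ_mul N)
    simpa only [map_mul, map_add, map_pow, map_natCast, map_one] using h
  have h2 := sub_X_mul_geomInv_add_two M N
  have h3 : (C (1 / 2) : ℝ⟦X⟧) * 2 = 1 := by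
    rw [← C_two, ← map_mul]
    norm_num
  simp only [gaussTerm, invRising_succ_left_mul, invRising]
  push_cast
  simp only [map_add, map_natCast, map_one]
  set g := geomInv ((M : ℝ) + N + 2)
  set P := invRising M N
  set a := C (binomSq N)
  set c := (M : ℝ⟦X⟧) + 1 - X with hc
  linear_combination (-c * P * g) * h1 + (a * c * P * (c - (N : ℝ⟦X⟧))) * h2 +
    (a * c * P * g * (c - (N : ℝ⟦X⟧))) * h3

theorem tendsto_natCast_mul_gaussTerm (M : ℕ) :
    Tendsto (fun N : ℕ => (N : ℝ⟦X⟧) * gaussTerm M N) atTop (𝓝 0) := by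
  rw [WithPiTopology.tendsto_iff_coeff_tendsto]
  intro m
  have h := (tendsto_harmonic_pow_div m).comp (tendsto_add_atTop_nat 1)
  have h' : Tendsto (fun N : ℕ => 2 * ((harmonic (N + 1) : ℝ) ^ m / (((N + 1 : ℕ) : ℝ) + 1)))
      atTop (𝓝 0) := by simpa using h.const_mul 2
  rw [map_zero]
  have e : ∀ N : ℕ, coeff m ((N : ℝ⟦X⟧) * gaussTerm M N) = N * coeff m (gaussTerm M N) :=
    fun N => by rw [← map_natCast (C : ℝ →+* ℝ⟦X⟧), coeff_C_mul]
  simp only [e]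
  refine squeeze_zero (fun N => mul_nonneg (Nat.cast_nonneg N) (coeffLE_gaussTerm M N m).1)
    (fun N => ?_) h'
  have h1 := (coeffLE_gaussTerm M N m).2
  have hH : (0 : ℝ) ≤ (harmonic (N + 1) : ℝ) ^ m := pow_nonneg (harmonic_cast_nonneg _) _
  have hN : (0 : ℝ) ≤ N := Nat.cast_nonneg N
  calc _ ≤ N * (1 / ((N : ℝ) + 1) * ((harmonic (N + 1) : ℝ) ^ m / ((N : ℝ) + 1))) := by
        refine mul_le_mul_of_nonneg_left (h1.trans ?_) hN
        rw [coeff_gaussTerm_zero]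
        exact mul_le_mul (binomSq_le N)
          (div_le_div_of_nonneg_right (mhsStar_ones_le _ _) (by positivity))
          (div_nonneg (mhsStar_nonneg _ _) (by positivity)) (by positivity)
    _ = (harmonic (N + 1) : ℝ) ^ m * (N / ((N : ℝ) + 1) ^ 2) := by
        field_simp
    _ ≤ (harmonic (N + 1) : ℝ) ^ m * (2 / (((N + 1 : ℕ) : ℝ) + 1)) := by
        refine mul_le_mul_of_nonneg_left ?_ hH
        push_cast
        rw [div_le_div_iff₀ (by positivity) (by positivity)]
        nlinarith
    _ = _ := by ring

/-- The sum `₂F₁(1/2, 1/2; M + 2 - X; 1) / (M + 1 - X)`. -/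
noncomputable def hyperSum (M : ℕ) : ℝ⟦X⟧ := ∑' N, gaussTerm M N

/-- The contiguity relation behind Gauss' summation theorem. -/
theorem hyperSum_contiguous (M : ℕ) :
    ((M : ℝ⟦X⟧) + 1 - X + C (1 / 2)) ^ 2 * hyperSum (M + 1) =
      ((M : ℝ⟦X⟧) + 1 - X) ^ 2 * hyperSum M := by
  have h1 := (((summable_gaussTerm (M + 1)).hasSum.mul_left
      (((M : ℝ⟦X⟧) + 1 - X + C (1 / 2)) ^ 2)).sub
    ((summable_gaussTerm M).hasSum.mul_left (((M : ℝ⟦X⟧) + 1 - X) ^ 2))).tendsto_sum_nat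
  simp only [gaussTerm_telescope, ← Finset.mul_sum,
    Finset.sum_range_sub (fun N : ℕ => (N : ℝ⟦X⟧) * gaussTerm M N)] at h1
  have h2 := ((tendsto_natCast_mul_gaussTerm M).sub_const
    (((0 : ℕ) : ℝ⟦X⟧) * gaussTerm M 0)).const_mul ((M : ℝ⟦X⟧) + 1 - X)
  have h3 := tendsto_nhds_unique h1 h2
  simp only [Nat.cast_zero, zero_mul, sub_zero, mul_zero] at h3
  exact sub_eq_zero.mp h3

theorem tendsto_inv_natCast_add (a : ℝ) :
    Tendsto (fun M : ℕ => ((M : ℝ) + a)⁻¹) atTop (𝓝 0) :=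
  tendsto_inv_atTop_zero.comp (tendsto_atTop_add_const_right _ _ tendsto_natCast_atTop_atTop)

theorem tendsto_natCast_mul_invRising (N : ℕ) :
    Tendsto (fun M : ℕ => C (M : ℝ) * invRising M N) atTop (𝓝 (if N = 0 then 1 else 0)) := by
  induction N with
  | zero =>
    rw [if_pos rfl, WithPiTopology.tendsto_iff_coeff_tendsto]
    intro k
    have h := (tendsto_natCast_div_add_atTop (1 : ℝ)).mul ((tendsto_inv_natCast_add 1).pow k)
    have h2 : (1 : ℝ) * 0 ^ k = coeff k (1 : ℝ⟦X⟧) := by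
      rw [one_mul, coeff_one, zero_pow_eq]
    rw [h2] at h
    refine h.congr fun M => ?_
    rw [invRising, coeff_C_mul, coeff_geomInv, pow_succ', div_eq_mul_inv, mul_assoc]
  | succ N ih =>
    have h : Tendsto (fun M : ℕ => geomInv ((M : ℝ) + N + 2)) atTop (𝓝 0) := by
      rw [WithPiTopology.tendsto_iff_coeff_tendsto]
      intro k
      have h := (tendsto_inv_natCast_add ((N : ℝ) + 2)).pow (k + 1)
      rw [zero_pow (Nat.succ_ne_zero k)] at h
      simpa only [coeff_geomInv, add_assoc, map_zero] using h
    have h2 := ih.mul (h.const_mul (C ((N : ℝ) + 1)))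
    rw [mul_zero, mul_zero] at h2
    simpa only [invRising, mul_assoc, Nat.succ_ne_zero, if_false] using h2

/-- After multiplication by `M`, only the term with `N = 0` survives in the limit. -/
theorem tendsto_natCast_mul_hyperSum :
    Tendsto (fun M : ℕ => C (M : ℝ) * hyperSum M) atTop (𝓝 1) := by
  rw [WithPiTopology.tendsto_iff_coeff_tendsto]
  intro m
  have e : ∀ M : ℕ, coeff m (C (M : ℝ) * hyperSum M) =
      ∑' N, coeff m (C (M : ℝ) * gaussTerm M N) := fun M => by
    have h := (summable_gaussTerm M).hasSum.mul_left (C (M : ℝ))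
    exact ((WithPiTopology.hasSum_iff_hasSum_coeff _ |>.mp h) m).tsum_eq.symm
  have e2 : coeff m (1 : ℝ⟦X⟧) = ∑' N : ℕ, if N = 0 then coeff m (1 : ℝ⟦X⟧) else 0 :=
    (tsum_ite_eq 0 fun _ => coeff m (1 : ℝ⟦X⟧)).symm
  simp only [e]
  rw [e2]
  refine tendsto_tsum_of_dominated_convergence (summable_coeff_gaussTerm_zero m) (fun N => ?_)
    (Eventually.of_forall fun M N => ?_)
  · have h := ((tendsto_natCast_mul_invRising N).const_mul (C (binomSq N)))
    rw [WithPiTopology.tendsto_iff_coeff_tendsto] at h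
    have h3 := h m
    by_cases hN : N = 0
    · subst hN
      simpa [gaussTerm, binomSq] using h3
    · simp only [hN, if_false, mul_zero, map_zero] at h3 ⊢
      simpa only [gaussTerm, mul_left_comm] using h3
  · rw [Real.norm_eq_abs, abs_of_nonneg (coeffLE_natCast_mul_gaussTerm M N m).1]
    exact (coeffLE_natCast_mul_gaussTerm M N m).2

/-! ### The product formula for the second series -/

/-- The coefficients of `(1 - 2 X / j) ^ (-2)`, scaled by `j ^ k`. -/
def gammaEven (k : ℕ) : ℚ := ((k : ℚ) + 1) * 2 ^ k

/-- The coefficients of `(1 - 2 X / j) ^ 2`, scaled by `j ^ k`. -/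
def gammaOdd : ℕ → ℚ
  | 0 => 1
  | 1 => -4
  | 2 => 4
  | _ + 3 => 0

/-- The product `∏_{j ≤ n} (1 - 2 X / j) ^ (∓ 2)`, with exponent `-2` for even and `2` for odd `j`.
The two signs balance, so the product converges. -/
noncomputable def gammaProd : ℕ → ℝ⟦X⟧ := parityProd gammaEven gammaOdd

theorem parityFactor_gamma_even (j : ℕ) :
    ((j : ℝ⟦X⟧) + 1 - X) ^ 2 * parityFactor gammaEven gammaOdd (2 * j + 2) =
      ((j : ℝ⟦X⟧) + 1) ^ 2 := by
  have h : parityFactor gammaEven gammaOdd (2 * j + 2) =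
      PowerSeries.mk fun k => ((k : ℝ) + 1) * (((j : ℝ) + 1)⁻¹) ^ k := by
    ext k
    have : Even (2 * j + 2) := ⟨j + 1, by ring⟩
    simp only [parityFactor, coeff_mk, this, if_true, gammaEven]
    by_cases hk : k = 0
    · simp [hk]
    · rw [if_neg hk]
      push_cast
      rw [show (2 : ℝ) * j + 2 = 2 * (j + 1) by ring, mul_pow]
      rw [inv_pow]
      field_simp
  have h1 := one_sub_sq_mul_mk_succ_mul_pow (((j : ℝ) + 1)⁻¹)
  have h2 := C_inv_mul_natCast j
  rw [← h] at h1
  set d := C (((j : ℝ) + 1)⁻¹)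
  have h3 : ((j : ℝ⟦X⟧) + 1 - X) = ((j : ℝ⟦X⟧) + 1) * (1 - d * X) := by
    linear_combination X * h2
  rw [h3]
  linear_combination ((j : ℝ⟦X⟧) + 1) ^ 2 * h1

theorem parityFactor_gamma_odd (j : ℕ) :
    (2 * (j : ℝ⟦X⟧) + 1) ^ 2 * parityFactor gammaEven gammaOdd (2 * j + 1) =
      (2 * (j : ℝ⟦X⟧) + 1 - 2 * X) ^ 2 := by
  set d : ℝ := (2 * (j : ℝ) + 1)⁻¹ with hd
  have hj : 2 * (j : ℝ) + 1 ≠ 0 := by positivity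
  have h2 : C d * (2 * (j : ℝ⟦X⟧) + 1) = 1 := by
    have : (2 * (j : ℝ⟦X⟧) + 1) = C (2 * (j : ℝ) + 1) := by simp [C_two]
    rw [this, ← map_mul, hd, inv_mul_cancel₀ hj, map_one]
  have h : parityFactor gammaEven gammaOdd (2 * j + 1) =
      1 + C (-4 * d) * X ^ 1 + C (4 * d ^ 2) * X ^ 2 := by
    ext k
    have : ¬ Even (2 * j + 1) := by simp
    simp only [parityFactor, coeff_mk, this, if_false, map_add, coeff_C_mul, coeff_X_pow, coeff_one]
    rcases k with _ | _ | _ | k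
    · simp
    · simp [gammaOdd, hd, div_eq_mul_inv]
    · simp [gammaOdd, hd, div_eq_mul_inv]
    · simp [gammaOdd]
  have h4 : (C 4 : ℝ⟦X⟧) = 4 := map_ofNat C 4
  rw [h]
  simp only [map_mul, map_neg, map_pow, h4]
  linear_combination (-4 * X * (2 * (j : ℝ⟦X⟧) + 1) +
    4 * X ^ 2 * (C d * (2 * (j : ℝ⟦X⟧) + 1) + 1)) * h2

/-- The contiguity relation, iterated `M` times. -/
theorem hyperSum_zero_eq (M : ℕ) :
    (1 - 2 * (X : ℝ⟦X⟧)) ^ 2 * hyperSum 0 =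
      C ((2 * (M : ℝ) + 1) ^ 2 * binomSq M) * hyperSum M * gammaProd (2 * M + 1) := by
  induction M with
  | zero =>
    have h := parityFactor_gamma_odd 0
    simp only [Nat.cast_zero, mul_zero, zero_add, one_pow, one_mul] at h
    simp [gammaProd, parityProd, binomSq, h]
    ring
  | succ M ih =>
    have h1 := hyperSum_contiguous M
    have h2 := parityFactor_gamma_even M
    have h3 := parityFactor_gamma_odd (M + 1)
    have h4 : C (binomSq (M + 1)) * ((M : ℝ⟦X⟧) + 1) ^ 2 =
        C (binomSq M) * ((M : ℝ⟦X⟧) + C (1 / 2)) ^ 2 := by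
      have h := congrArg (C : ℝ →+* ℝ⟦X⟧) (binomSq_succ_mul M)
      simpa only [map_mul, map_add, map_pow, map_natCast, map_one] using h
    have h5 : (2 : ℝ⟦X⟧) * C (1 / 2) = 1 := by
      rw [← C_two, ← map_mul]
      norm_num
    have h6 : gammaProd (2 * (M + 1) + 1) = gammaProd (2 * M + 1) *
        parityFactor gammaEven gammaOdd (2 * M + 2) *
        parityFactor gammaEven gammaOdd (2 * (M + 1) + 1) := rfl
    rw [ih, h6]
    push_cast at *
    simp only [map_mul, map_add, map_pow, map_natCast, map_one, C_two] at *
    set G := hyperSum (M + 1)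
    set Q := gammaProd (2 * M + 1)
    set p := parityFactor gammaEven gammaOdd (2 * M + 2)
    set q := parityFactor gammaEven gammaOdd (2 * (M + 1) + 1)
    set a' := C (binomSq (M + 1))
    have h7 : (2 * ((M : ℝ⟦X⟧) + 1) + 1 - 2 * X) ^ 2 =
        4 * ((M : ℝ⟦X⟧) + 1 - X + C (1 / 2)) ^ 2 := by
      linear_combination (-(2 * ((M : ℝ⟦X⟧) + 1 - X) * 2 + 1 + 2 * C (1 / 2))) * h5
    have h8 : (2 * (M : ℝ⟦X⟧) + 1) ^ 2 = 4 * ((M : ℝ⟦X⟧) + C (1 / 2)) ^ 2 := by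
      linear_combination (-(4 * (M : ℝ⟦X⟧) + 1 + 2 * C (1 / 2))) * h5
    linear_combination C (binomSq M) * hyperSum M * Q * h8 - 4 * hyperSum M * Q * h4 -
      4 * a' * hyperSum M * Q * h2 - 4 * a' * Q * p * h1 - a' * G * Q * p * h7 - a' * G * Q * p * h3

theorem tendsto_mul_hyperSum :
    Tendsto (fun M : ℕ => C ((2 * (M : ℝ) + 1) ^ 2 * binomSq M) * hyperSum M) atTop
      (𝓝 (C (4 / Real.pi))) := by
  have h1 : Tendsto (fun M : ℕ => 2 + 1 / (M : ℝ)) atTop (𝓝 2) := by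
    simpa using (tendsto_const_div_atTop_nhds_zero_nat (1 : ℝ)).const_add 2
  have h2 := (WithPiTopology.continuous_C (R := ℝ)).tendsto _ |>.comp
    (h1.mul tendsto_odd_mul_binomSq)
  have h3 := h2.mul tendsto_natCast_mul_hyperSum
  rw [mul_one, mul_div_assoc', show (2 : ℝ) * 2 = 4 by norm_num] at h3
  refine h3.congr' ?_
  filter_upwards [eventually_ge_atTop 1] with M hM
  have hM : (M : ℝ) ≠ 0 := by positivity
  simp only [Function.comp]
  rw [← mul_assoc, ← map_mul]
  congr 2
  field_simp

/-- The letter `(1, 1)` does not occur because the coefficients in degree one,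
`gammaEven 1 = 4` and `gammaOdd 1 = -4`, cancel. -/
theorem coeff_gammaProd_mem (m : ℕ) :
    (fun n => ((coeff m (gammaProd n) : ℝ) : ℂ)) ∈ partialSpan {w | CMZVAdmissible 2 w} := by
  refine partialSpan_mono ?_ (coeff_parityProd_mem (A := {p | 1 ≤ p.1 ∧ p.2 ^ 2 = 1 ∧ p ≠ (1, 1)})
    (fun k hk h => ⟨hk, by simp, ?_⟩) (fun k hk => ⟨hk, by simp, ?_⟩) m)
  · intro w hw
    exact ⟨fun p hp => ⟨(hw p hp).1, (hw p hp).2.1⟩,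
      fun p hp => (hw p (List.mem_of_mem_head? hp)).2.2⟩
  · intro h1
    obtain rfl : k = 1 := congrArg Prod.fst h1
    norm_num [gammaEven, gammaOdd] at h
  · intro h1
    have := congrArg Prod.snd h1
    norm_num at this

/-- Multiplication by `(1 - 2 X) ^ (-2)` preserves the property that all coefficients lie in a
given `ℚ`-subspace of `ℂ`. -/
theorem coeff_mk_mul_mem {V : Submodule ℚ ℂ} {P : ℝ⟦X⟧} (h : ∀ m, ((coeff m P : ℝ) : ℂ) ∈ V)
    (m : ℕ) : ((coeff m ((PowerSeries.mk fun k => ((k : ℝ) + 1) * 2 ^ k) * P) : ℝ) : ℂ) ∈ V := by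
  rw [coeff_mul, Complex.ofReal_sum]
  refine sum_mem fun p _ => ?_
  have h1 := V.smul_mem (((p.1 : ℚ) + 1) * 2 ^ p.1) (h p.2)
  rw [Rat.smul_def] at h1
  rw [coeff_mk]
  push_cast at h1 ⊢
  exact h1

theorem tsum_binomSq_mul_mhsStar_mem (m : ℕ) :
    ∃ y : ℝ, (y : ℂ) ∈ CMZVle 2 ∧
      ∑' n : ℕ, binomSq n * (mhsStar (ones m) (n + 1) / ((n : ℝ) + 1)) = 4 / Real.pi * y := by
  choose q hq hlim using fun m =>
    exists_real_tendsto_of_mem_partialSpan one_le_two (coeff_gammaProd_mem m)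
  have h1 : Tendsto gammaProd atTop (𝓝 (PowerSeries.mk q)) := by
    rw [WithPiTopology.tendsto_iff_coeff_tendsto]
    simpa only [coeff_mk] using hlim
  have h2 : Tendsto (fun M : ℕ => 2 * M + 1) atTop atTop :=
    tendsto_atTop_mono (fun M => by simp only [id]; omega) tendsto_id
  have h3 := tendsto_mul_hyperSum.mul (h1.comp h2)
  have h4 : (1 - 2 * (X : ℝ⟦X⟧)) ^ 2 * hyperSum 0 = C (4 / Real.pi) * PowerSeries.mk q := by
    refine tendsto_nhds_unique (tendsto_const_nhds.congr fun M => ?_) h3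
    exact hyperSum_zero_eq M
  have h5 := one_sub_sq_mul_mk_succ_mul_pow 2
  rw [C_two] at h5
  refine ⟨coeff m ((PowerSeries.mk fun k => ((k : ℝ) + 1) * 2 ^ k) * PowerSeries.mk q),
    coeff_mk_mul_mem (fun m => by simpa only [coeff_mk] using hq m) m, ?_⟩
  have h6 : hyperSum 0 = C (4 / Real.pi) *
      ((PowerSeries.mk fun k => ((k : ℝ) + 1) * 2 ^ k) * PowerSeries.mk q) := by
    linear_combination (PowerSeries.mk fun k => ((k : ℝ) + 1) * 2 ^ k) * h4 - hyperSum 0 * h5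
  rw [← coeff_C_mul, ← h6]
  simp only [← coeff_gaussTerm_zero]
  exact ((WithPiTopology.hasSum_iff_hasSum_coeff _ |>.mp (summable_gaussTerm 0).hasSum) m).tsum_eq

end Gauss

section Alternating

open PowerSeries
open scoped PowerSeries.WithPiTopology

/-! ### The first series at level four -/

/-- The coefficients of `(1 + 2 X / j) / (1 - 2 X / j)` in positive degree, scaled by `j ^ k`. -/
def cayleyEven (k : ℕ) : ℚ := 2 ^ (k + 1)

/-- The product `∏_{j ≤ n} (1 + 2 X / j) / (1 - 2 X / j)` over even `j`. Its value at `2 n` is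
`∏_{j ≤ n} (j + X) / (j - X)`. -/
noncomputable def cayleyProd : ℕ → ℝ⟦X⟧ := parityProd cayleyEven 0

theorem cayleyProd_two_mul_add_two (n : ℕ) :
    cayleyProd (2 * n + 2) =
      cayleyProd (2 * n) * ((n : ℝ⟦X⟧) + 1 + X) * geomInv ((n : ℝ) + 1) := by
  have h1 : parityFactor cayleyEven 0 (2 * n + 1) = 1 := by
    ext k
    have : ¬ Even (2 * n + 1) := by simp
    simp only [parityFactor, coeff_mk, this, if_false, coeff_one]
    simp
  have h2 : parityFactor cayleyEven 0 (2 * n + 2) =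
      1 + 2 * (X * C (((n : ℝ) + 1)⁻¹) * PowerSeries.mk fun k => (((n : ℝ) + 1)⁻¹) ^ k) := by
    ext k
    have : Even (2 * n + 2) := ⟨n + 1, by ring⟩
    simp only [parityFactor, coeff_mk, this, if_true, cayleyEven, map_add, coeff_one]
    rw [← C_two, coeff_C_mul, mul_assoc]
    cases k with
    | zero => simp
    | succ k =>
      rw [coeff_succ_X_mul, coeff_C_mul, coeff_mk, if_neg (Nat.succ_ne_zero k),
        if_neg (Nat.succ_ne_zero k)]
      push_cast
      rw [show (2 : ℝ) * n + 2 = 2 * (n + 1) by ring, mul_pow, ← pow_succ', inv_pow]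
      field_simp
      ring
  have h3 : cayleyProd (2 * n + 2) = cayleyProd (2 * n) * parityFactor cayleyEven 0 (2 * n + 1) *
      parityFactor cayleyEven 0 (2 * n + 2) := rfl
  have h4 := one_sub_mul_mk_pow (((n : ℝ) + 1)⁻¹)
  have h5 := C_inv_mul_natCast n
  have h6 := sub_X_mul_geomInv_add_one n
  rw [h3, h1, h2]
  set d := C (((n : ℝ) + 1)⁻¹)
  set E := PowerSeries.mk fun k => (((n : ℝ) + 1)⁻¹) ^ k
  set g := geomInv ((n : ℝ) + 1)
  have h7 : d * E = g := by
    linear_combination ((n : ℝ⟦X⟧) + 1) * d * g * h4 + (g * (1 + d * X * E)) * h5 -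
      d * E * h6
  rw [mul_assoc X, h7]
  linear_combination (-cayleyProd (2 * n)) * h6

theorem legendreGen_succ_eq_cayleyProd (n : ℕ) :
    legendreGen (n + 1) =
      X * cayleyProd (2 * n) * geomInv ((n : ℝ) + 1) * geomInv ((n : ℝ) + 2) := by
  induction n with
  | zero =>
    simp only [legendreGen, cayleyProd, parityProd, Nat.cast_zero, zero_add, mul_one]
    ring
  | succ n ih =>
    rw [legendreGen, ih, show 2 * (n + 1) = 2 * n + 2 by ring, cayleyProd_two_mul_add_two]
    push_cast
    rw [show (n : ℝ) + 1 + 1 = n + 2 by ring]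
    ring

/-- The partial fraction decomposition of `1 / ((n + X) (n + 1 - X) (2 n + 1))` turns the moments
of Legendre polynomials into differences of consecutive values of `cayleyProd`, which telescope,
and a sum over odd integers. -/
theorem one_sub_sq_mul_sum_legendreGen (M : ℕ) :
    (1 - 2 * X) ^ 2 * ∑ n ∈ Finset.range (M + 1),
        C ((-1) ^ n * (2 * (n : ℝ) + 1)⁻¹) * legendreGen n =
      1 + (-1) ^ M * X * (cayleyProd (2 * M) * geomInv ((M : ℝ) + 1)) -
        4 * X * ∑ n ∈ Finset.range (M + 1),
          C ((-1) ^ n * (2 * (n : ℝ) + 1)⁻¹) * cayleyProd (2 * n) := by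
  induction M with
  | zero =>
    have h := one_sub_X_mul_legendreGen_zero
    simp only [legendreGen] at h
    simp [legendreGen, cayleyProd, parityProd]
    linear_combination (1 - 4 * X) * h
  | succ M ih =>
    rw [Finset.sum_range_succ, mul_add, ih, Finset.sum_range_succ _ (M + 1),
      legendreGen_succ_eq_cayleyProd, show 2 * (M + 1) = 2 * M + 2 by ring,
      cayleyProd_two_mul_add_two]
    have h1 := sub_X_mul_geomInv (c := (M : ℝ) + 2) (by positivity)
    have h2 : C ((2 * ((M : ℝ) + 1) + 1)⁻¹) * (2 * ((M : ℝ⟦X⟧) + 1) + 1) = 1 := by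
      have h : 2 * ((M : ℝ⟦X⟧) + 1) + 1 = C (2 * ((M : ℝ) + 1) + 1) := by simp [C_two]
      rw [h, ← map_mul, inv_mul_cancel₀ (by positivity), map_one]
    push_cast
    rw [show (M : ℝ) + 1 + 1 = M + 2 by ring]
    simp only [map_mul, map_add, map_pow, map_neg, map_natCast, map_one, C_two] at *
    set d := C ((2 * ((M : ℝ) + 1) + 1)⁻¹)
    set g := geomInv ((M : ℝ) + 1)
    set h := geomInv ((M : ℝ) + 2)
    set v := cayleyProd (2 * M)
    set T := ∑ n ∈ Finset.range (M + 1),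
      (-1) ^ n * C ((2 * (n : ℝ) + 1)⁻¹) * cayleyProd (2 * n)
    linear_combination (-1) ^ M * X * v * g * (4 * d * ((M : ℝ⟦X⟧) + 1 + X) - 1) * h1 -
      (-1) ^ M * X * v * g * h * (2 * ((M : ℝ⟦X⟧) + 1) + 1) * h2

theorem coeff_cayleyProd_mem (m : ℕ) :
    (fun n => ((coeff m (cayleyProd n) : ℝ) : ℂ)) ∈
      partialSpan (wordsIn {p | 1 ≤ p.1 ∧ p.2 ^ 2 = 1}) :=
  coeff_parityProd_mem (A := {p | 1 ≤ p.1 ∧ p.2 ^ 2 = 1}) (fun k hk _ => ⟨hk, by simp⟩)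
    (fun k hk => ⟨hk, by simp⟩) m

theorem tendsto_div_of_mem_partialSpan {N : ℕ} (hN : N ≠ 0) {g : ℕ → ℂ}
    (hg : g ∈ partialSpan (wordsIn {p | 1 ≤ p.1 ∧ p.2 ^ N = 1})) :
    Tendsto (fun n => g n / ((n : ℂ) + 1)) atTop (𝓝 0) := by
  refine Submodule.span_induction ?_ ?_ ?_ ?_ hg
  · rintro _ ⟨w, hw, rfl⟩
    refine squeeze_zero_norm (fun j => ?_) (tendsto_harmonic_pow_div w.length)
    rw [norm_div, norm_natCast_add_one]
    exact div_le_div_of_nonneg_right (norm_cmzvPartial_le w (fun p hp =>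
      ⟨(hw p hp).1, (Complex.norm_eq_one_of_pow_eq_one (hw p hp).2 hN).le⟩) j) (by positivity)
  · simp
  · rintro g h _ _ hg hh
    simpa [add_div] using hg.add hh
  · rintro c g _ hg
    simpa [smul_div_assoc] using hg.const_smul c

theorem tendsto_cayleyProd_mul_geomInv :
    Tendsto (fun M : ℕ => cayleyProd (2 * M) * geomInv ((M : ℝ) + 1)) atTop (𝓝 0) := by
  have hdouble : Tendsto (fun M : ℕ => 2 * M) atTop atTop :=
    tendsto_atTop_mono (fun M => by simp only [id]; omega) tendsto_id
  have h1 : Tendsto (fun M : ℕ => C ((2 * (M : ℝ) + 1)⁻¹) * cayleyProd (2 * M)) atTop (𝓝 0) := by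
    rw [WithPiTopology.tendsto_iff_coeff_tendsto]
    intro m
    have h := (Complex.continuous_re.tendsto _).comp
      ((tendsto_div_of_mem_partialSpan two_ne_zero (coeff_cayleyProd_mem m)).comp hdouble)
    rw [map_zero]
    refine h.congr fun M => ?_
    simp only [Function.comp]
    rw [coeff_C_mul, inv_mul_eq_div, ← Complex.ofReal_natCast, ← Complex.ofReal_one,
      ← Complex.ofReal_add, ← Complex.ofReal_div, Complex.ofReal_re]
    push_cast
    rfl
  have h2 : Tendsto (fun M : ℕ => C (2 * (M : ℝ) + 1) * geomInv ((M : ℝ) + 1)) atTop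
      (𝓝 (PowerSeries.mk fun k => 2 * 0 ^ k)) := by
    rw [WithPiTopology.tendsto_iff_coeff_tendsto]
    intro k
    have h3 : Tendsto (fun M : ℕ => 2 - ((M : ℝ) + 1)⁻¹) atTop (𝓝 2) := by
      simpa using (tendsto_inv_natCast_add 1).const_sub 2
    rw [coeff_mk]
    refine (h3.mul ((tendsto_inv_natCast_add 1).pow k)).congr fun M => ?_
    rw [coeff_C_mul, coeff_geomInv, pow_succ', ← mul_assoc]
    congr 1
    have : (M : ℝ) + 1 ≠ 0 := by positivity
    field_simp
    ring
  have h3 := h1.mul h2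
  rw [zero_mul] at h3
  refine h3.congr fun M => ?_
  have h4 : C ((2 * (M : ℝ) + 1)⁻¹) * C (2 * (M : ℝ) + 1) = 1 := by
    rw [← map_mul, inv_mul_cancel₀ (by positivity), map_one]
  linear_combination (cayleyProd (2 * M) * geomInv ((M : ℝ) + 1)) * h4

/-- The odd integers `j = 2 n + 1` and the sign `(-1) ^ n` are detected by
`(I ^ j - (-I) ^ j) / (2 I)`. -/
theorem prependLetter_I_sub (g : ℕ → ℂ) (M : ℕ) :
    prependLetter (1, Complex.I) g (2 * M) - prependLetter (1, -Complex.I) g (2 * M) =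
      2 * Complex.I * ∑ n ∈ Finset.range M, (-1) ^ n / (2 * (n : ℂ) + 1) * g (2 * n) := by
  induction M with
  | zero => simp [prependLetter_apply]
  | succ M ih =>
    rw [show 2 * (M + 1) = 2 * M + 1 + 1 by ring, prependLetter_succ _ _ (2 * M + 1),
      prependLetter_succ _ _ (2 * M), prependLetter_succ _ _ (2 * M + 1),
      prependLetter_succ _ _ (2 * M), Finset.sum_range_succ,
      mul_add, ← ih]
    have h1 : Complex.I ^ (2 * M + 1) = (-1) ^ M * Complex.I := by
      rw [pow_succ, pow_mul, Complex.I_sq]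
    have h2 : (-Complex.I) ^ (2 * M + 1) = -((-1) ^ M * Complex.I) := by
      rw [pow_succ, pow_mul, neg_sq, Complex.I_sq, mul_neg]
    have h3 : (-Complex.I) ^ (2 * M + 1 + 1) = Complex.I ^ (2 * M + 1 + 1) :=
      Even.neg_pow ⟨M + 1, by ring⟩ _
    simp only [h1, h2, h3]
    push_cast
    ring

theorem exists_tendsto_sum_cayleyProd (m : ℕ) :
    ∃ y : ℝ, (y : ℂ) ∈ (CMZVle 4).map (LinearMap.mulLeft ℚ Complex.I) ∧
      Tendsto (fun M => ∑ n ∈ Finset.range M,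
        (-1) ^ n * (2 * (n : ℝ) + 1)⁻¹ * coeff m (cayleyProd (2 * n))) atTop (𝓝 y) := by
  have hI : ∀ z : ℂ, z ^ 4 = 1 → z ≠ 1 → ∀ w ∈ wordsIn {p : ℕ × ℂ | 1 ≤ p.1 ∧ p.2 ^ 2 = 1},
      (1, z) :: w ∈ {w | CMZVAdmissible 4 w} := fun z hz hz1 w hw => by
    refine ⟨fun p hp => ?_, fun p hp => ?_⟩
    · rcases List.mem_cons.mp hp with rfl | hp
      · exact ⟨le_rfl, hz⟩
      · refine ⟨(hw p hp).1, ?_⟩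
        rw [show 4 = 2 * 2 by rfl, pow_mul, (hw p hp).2, one_pow]
    · simp only [List.head?_cons, Option.mem_def, Option.some.injEq] at hp
      rw [← hp]
      exact fun h => hz1 (congrArg Prod.snd h)
  obtain ⟨a, ha, hal⟩ := exists_tendsto_of_mem_partialSpan (by norm_num)
    (prependLetter_mem (hI Complex.I Complex.I_pow_four
      (fun h => by simpa using congrArg Complex.re h)) (coeff_cayleyProd_mem m))
  obtain ⟨b, hb, hbl⟩ := exists_tendsto_of_mem_partialSpan (by norm_num)
    (prependLetter_mem (hI (-Complex.I) (by rw [Even.neg_pow ⟨2, rfl⟩, Complex.I_pow_four])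
      (fun h => by simpa using congrArg Complex.re h)) (coeff_cayleyProd_mem m))
  have hdouble : Tendsto (fun M : ℕ => 2 * M) atTop atTop :=
    tendsto_atTop_mono (fun M => by simp only [id]; omega) tendsto_id
  set s : ℂ := (1 / 2 : ℚ) • (b - a) with hs
  have h1 : Tendsto (fun M => ((∑ n ∈ Finset.range M,
      (-1) ^ n * (2 * (n : ℝ) + 1)⁻¹ * coeff m (cayleyProd (2 * n)) : ℝ) : ℂ)) atTop
      (𝓝 (Complex.I * s)) := by
    have h2 := ((hal.sub hbl).comp hdouble).const_mul (2 * Complex.I)⁻¹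
    have h3 : (2 * Complex.I)⁻¹ * (a - b) = Complex.I * s := by
      rw [hs, Rat.smul_def, mul_inv, Complex.inv_I]
      push_cast
      ring
    rw [h3] at h2
    refine h2.congr fun M => ?_
    simp only [Function.comp]
    rw [prependLetter_I_sub, inv_mul_cancel_left₀ (by simp)]
    push_cast
    simp only [div_eq_mul_inv]
  have h4 := (Complex.continuous_re.tendsto _).comp h1
  simp only [Function.comp_def, Complex.ofReal_re] at h4
  refine ⟨(Complex.I * s).re, ?_, h4⟩
  have h5 := tendsto_nhds_unique h1 ((Complex.continuous_ofReal.tendsto _).comp h4)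
  rw [← h5]
  exact ⟨s, Submodule.smul_mem _ _ (sub_mem hb ha), rfl⟩

theorem tsum_alternating_legendreGen_mem (m : ℕ) :
    ∃ u ∈ CMZVle 4, ∃ v ∈ CMZVle 4,
      ((∑' n : ℕ, (-1) ^ n * (coeff m (legendreGen n) / (2 * (n : ℝ) + 1)) : ℝ) : ℂ) =
        u + Complex.I * v := by
  choose y hy hlim using exists_tendsto_sum_cayleyProd
  set U : ℝ⟦X⟧ := PowerSeries.mk fun m =>
    ∑' n : ℕ, (-1) ^ n * (coeff m (legendreGen n) / (2 * (n : ℝ) + 1)) with hU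
  have hsucc := tendsto_add_atTop_nat 1
  have h1 : Tendsto (fun M : ℕ => ∑ n ∈ Finset.range M,
      C ((-1) ^ n * (2 * (n : ℝ) + 1)⁻¹) * cayleyProd (2 * n)) atTop
      (𝓝 (PowerSeries.mk y)) := by
    rw [WithPiTopology.tendsto_iff_coeff_tendsto]
    simpa only [map_sum, coeff_C_mul, coeff_mk] using hlim
  have h2 : Tendsto (fun M : ℕ => ∑ n ∈ Finset.range M,
      C ((-1) ^ n * (2 * (n : ℝ) + 1)⁻¹) * legendreGen n) atTop (𝓝 U) := by
    rw [WithPiTopology.tendsto_iff_coeff_tendsto]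
    intro m
    rw [hU, coeff_mk]
    refine (summable_sign_mul_coeff_legendreGen_div m (s := fun n => (-1) ^ n)
      (fun n => by simp)).hasSum.tendsto_sum_nat.congr fun M => ?_
    rw [map_sum]
    refine Finset.sum_congr rfl fun n _ => ?_
    rw [coeff_C_mul, mul_assoc, inv_mul_eq_div]
  have h3 : Tendsto (fun M : ℕ => ((-1) ^ M * X * (cayleyProd (2 * M) * geomInv ((M : ℝ) + 1)) :
      ℝ⟦X⟧)) atTop (𝓝 0) := by
    have h := tendsto_cayleyProd_mul_geomInv
    rw [WithPiTopology.tendsto_iff_coeff_tendsto] at h ⊢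
    intro k
    rw [map_zero]
    have e : ∀ M : ℕ, coeff k ((-1) ^ M * X * (cayleyProd (2 * M) * geomInv ((M : ℝ) + 1)) :
        ℝ⟦X⟧) = (-1) ^ M * coeff k (X * (cayleyProd (2 * M) * geomInv ((M : ℝ) + 1))) := by
      intro M
      rw [mul_assoc, show ((-1) ^ M : ℝ⟦X⟧) = C ((-1) ^ M) by simp, coeff_C_mul]
    cases k with
    | zero => simp [e]
    | succ k =>
      have hk := h k
      rw [map_zero] at hk
      refine squeeze_zero_norm (fun M => ?_) (tendsto_zero_iff_norm_tendsto_zero.mp hk)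
      rw [e, coeff_succ_X_mul]
      simp
  have h4 : (1 - 2 * X) ^ 2 * U = 1 - 4 * X * PowerSeries.mk y := by
    have ha := (h2.comp hsucc).const_mul ((1 - 2 * X) ^ 2)
    have hb := (h3.const_add 1).sub ((h1.comp hsucc).const_mul (4 * X))
    rw [add_zero] at hb
    exact tendsto_nhds_unique (ha.congr fun M => one_sub_sq_mul_sum_legendreGen M) hb
  have h5 := one_sub_sq_mul_mk_succ_mul_pow 2
  rw [C_two] at h5
  set D : ℝ⟦X⟧ := PowerSeries.mk fun k => ((k : ℝ) + 1) * 2 ^ k with hD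
  have h6 : U = D * 1 - D * (X * (C 4 * PowerSeries.mk y)) := by
    rw [show (C 4 : ℝ⟦X⟧) = 4 from map_ofNat C 4]
    linear_combination D * h4 - U * h5
  have h7 : ((coeff m (D * 1) : ℝ) : ℂ) ∈ CMZVle 4 := by
    refine coeff_mk_mul_mem (fun k => ?_) m
    rw [coeff_one]
    by_cases hk : k = 0
    · simpa [hk] using one_mem_CMZVle (by norm_num)
    · simp [hk]
  have h8 : ((coeff m (D * (X * (C 4 * PowerSeries.mk y))) : ℝ) : ℂ) ∈
      (CMZVle 4).map (LinearMap.mulLeft ℚ Complex.I) := by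
    refine coeff_mk_mul_mem (fun k => ?_) m
    cases k with
    | zero => simp
    | succ k =>
      rw [coeff_succ_X_mul, coeff_C_mul, coeff_mk]
      have h := Submodule.smul_mem _ (4 : ℚ) (hy k)
      rw [Rat.smul_def] at h
      push_cast at h ⊢
      exact h
  obtain ⟨v, hv, hvI⟩ := h8
  refine ⟨_, h7, -v, neg_mem hv, ?_⟩
  have h9 := congrArg (fun P => ((coeff m P : ℝ) : ℂ)) h6
  simp only [hU, coeff_mk, map_sub, Complex.ofReal_sub] at h9
  rw [h9, ← hvI, LinearMap.mulLeft_apply, mul_neg, sub_eq_add_neg]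

end Alternating

theorem mainTheorem9 (m : ℕ) :
    -- all series involved converge
    Summable (fun n : ℕ => binomSq n * (1 / ((n : ℝ) + 1) ^ (m + 1))) ∧
    Summable (fun n : ℕ => binomSq n * (mhsStar (ones m) (n + 1) / ((n : ℝ) + 1))) ∧
    (∀ k ∈ Finset.Icc 1 m,
      Summable (fun n : ℕ+ => doubleTerm m k n * (-1) ^ (n : ℕ)) ∧
      Summable (fun n : ℕ+ => doubleTerm m k n)) ∧
    -- the two explicit formulas
    ∑' n : ℕ, binomSq n * (1 / ((n : ℝ) + 1) ^ (m + 1)) =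
      4 / Real.pi *
        (1 + ∑ k ∈ Finset.Icc 1 m, ∑' n : ℕ+, doubleTerm m k n * (-1) ^ (n : ℕ)) ∧
    ∑' n : ℕ, binomSq n * (mhsStar (ones m) (n + 1) / ((n : ℝ) + 1)) =
      4 / Real.pi * (1 + ∑ k ∈ Finset.Icc 1 m, ∑' n : ℕ+, doubleTerm m k n) ∧
    -- the first sum lies in `(1/π) (CMZV^{≤4} + i CMZV^{≤4})`
    (∃ u ∈ CMZVle 4, ∃ v ∈ CMZVle 4,
      ((∑' n : ℕ, binomSq n * (1 / ((n : ℝ) + 1) ^ (m + 1)) : ℝ) : ℂ) =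
        1 / (Real.pi : ℂ) * (u + Complex.I * v)) ∧
    -- the second sum lies in `(1/π) CMZV^{≤2}`
    (∃ v ∈ CMZVle 2,
      ((∑' n : ℕ, binomSq n * (mhsStar (ones m) (n + 1) / ((n : ℝ) + 1)) : ℝ) : ℂ) =
        1 / (Real.pi : ℂ) * v) := by
  have h1 := hasSum_binomSq_div_pow m
  have h2 := hasSum_binomSq_mul_mhsStar m
  refine ⟨h1.summable, h2.summable, fun k hk => ⟨?_, ?_⟩, ?_, ?_, ?_, ?_⟩
  · rw [summable_pnat_iff_summable_succ (f := fun n => doubleTerm m k n * (-1) ^ n)]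
    simpa only [mul_comm] using
      summable_sign_mul_doubleTerm_succ hk (s := fun n => (-1) ^ n) fun n => by simp
  · rw [summable_pnat_iff_summable_succ (f := fun n => doubleTerm m k n)]
    exact summable_doubleTerm_succ hk
  · rw [h1.tsum_eq, tsum_sign_mul_coeff_legendreGen_div m (s := fun n => (-1) ^ n)
      (fun n => by simp) (pow_zero _)]
  · have h := tsum_sign_mul_coeff_legendreGen_div m (s := fun _ => 1) (fun n => by simp) rfl
    simp only [one_mul, mul_one] at h
    rw [h2.tsum_eq, h]
  · obtain ⟨u, hu, v, hv, h⟩ := tsum_alternating_legendreGen_mem m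
    refine ⟨_, Submodule.smul_mem _ (4 : ℚ) hu, _, Submodule.smul_mem _ (4 : ℚ) hv, ?_⟩
    rw [h1.tsum_eq, Complex.ofReal_mul, h, Rat.smul_def, Rat.smul_def]
    push_cast
    ring
  · obtain ⟨y, hy, h⟩ := tsum_binomSq_mul_mhsStar_mem m
    refine ⟨_, Submodule.smul_mem _ (4 : ℚ) hy, ?_⟩
    rw [h, Rat.smul_def]
    push_cast
    ring
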